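/- Let $(M,c)$ be a conformal manifold of dimension $m$: $L$ is the real line bundle associated with the frame bundle of $M$ and the representation $|\det|^{1/m}$, and $c$ is a smooth positive definite symmetric bilinear form on $TM$ with values in $L^2$, normalized so that $|\det c|:(\Lambda^mTM)^2\to L^{2m}$ is the identity. Let $N\subset M$ be a smooth submanifold of dimension $n$ with $2\le n<m$. A Weyl structure is a torsion-free connection $\nabla$ on $TM$ with $\nabla c=0$; denote by $\nabla$ also the induced connection on $L$, by $R^\nabla$ its curvature, by $F^\nabla$ its Faraday form $\frac1m\operatorname{tr}R^\nabla$, by $\operatorname{Ric}^\nabla(X,Y)=\operatorname{tr}(R^\nabla_{\cdot,X}Y)$ its Ricci tensor, by $$h^\nabla=\tfrac1{m-2}(\operatorname{Ric}^{\nabla})^{s}_0+\tfrac1{2m(m-1)}\operatorname{tr}_c(\operatorname{Ric}^\nabla)\,c-\tfrac12F^\nabla$$ its Schouten–Weyl tensor ($s$ = symmetric part, $0$ = trace-free part), and by $\operatorname{Hess}^\nabla(X,Y)l=\nabla_X\nabla_Yl-\nabla_{\nabla_XY}l$ the Hessian on sections of $L$. The canonical Möbius operator of $M$ is $$\mathcal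 M^M_{(X,Y)}l=\operatorname{Hess}^{\nabla}_0(X,Y)l+h^{\nabla,s}_0(X,Y)l\qquad(X,Y\in TM),$$ where both terms are the symmetric trace-free parts. Let $B(X,Y)=(\nabla_XY)^\perp$ ($X,Y\in TN$) be the fundamental form of $N$, decomposed as $B=H^\nabla\cdot c+B_0$ into mean curvature $H^\nabla\in\nu^*\simeq \nu\otimes L^{-2}$ ($\nu$ the normal bundle) and trace-free part. The induced Möbius operator of $N$, acting on sections $l$ of $L|_N$, is $$\mathcal M^{ind}(X,Y)l=P_0(X,Y)l+H^\nabla(B_0(X,Y))l,\qquad P(X,Y)l=\nabla_X\nabla_Yl-\nabla_{(\nabla_XY)^N}l+h^\nabla(X,Y)l\qquad(X,Y\in TN),$$ where $P_0$ is the trace-free part of $P$ along $TN$. Let $l$ be a non-vanishing section of $L$ over $N$, and let $l^{min}$ be a smooth non-vanishing section of $L$ over an open neighbourhood $U$ of $N$ in $M$ that extends $l$ and such that $N$ is a minimal submanifold of $U$ with the Riemannian metric $(l^{min})^{-2}c$. Then $$\mathcal M^{ind}l=\mathcal M^M l^{min}$$ as sections of $S^2_0N\otimes L$, where the right-hand side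 is projected to $S^2_0N\otimes L$, i.e. restricted to $TN\otimes TN$ and replaced by its trace-free part along $TN$: $$\mathcal M^{ind}(X,Y)l=\bigl(\mathcal M^M l^{min}|_{TN\otimes TN}\bigr)_{0,N}(X,Y)\qquad\text{for all }X,Y\in TN.$$ This holds whichever Weyl structures of $(M,c)$ are used to compute the two operators (possibly two different ones). -/

import Mathlib

open scoped Manifold ContDiff
open Bundle

noncomputable section

namespace ConfGeom

/-! ### Linear algebra -/

/-- The line `L^k` of an `m`-dimensional real vector space `V`: the functions on the frames of `V`
with `φ (f v) = |det f| ^ (-k/m) φ v`, i.e. the line associated with the frames of `V` and the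
representation `|det| ^ (k/m)`. (Such a function is extended by `0` to degenerate tuples.)
Thus `L^m` is the line `|Λ^m V|`, and vectors of `V` have weight `1`. -/
def weightSpace (m : ℕ) (k : ℝ) (V : Type*) [AddCommGroup V] [Module ℝ V] :
    Submodule ℝ ((Fin m → V) → ℝ) where
  carrier := {φ | (∀ (f : V ≃ₗ[ℝ] V) (v : Fin m → V),
      φ (fun i => f (v i)) = |LinearMap.det (f : V →ₗ[ℝ] V)| ^ (-k / m) * φ v) ∧
    ∀ v : Fin m → V, ¬ LinearIndependent ℝ v → φ v = 0}
  add_mem' := by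
    rintro φ ψ ⟨h1, h2⟩ ⟨h3, h4⟩
    refine ⟨fun f v => ?_, fun v hv => ?_⟩
    · simp only [Pi.add_apply, h1, h3, mul_add]
    · simp only [Pi.add_apply, h2 v hv, h4 v hv, add_zero]
  zero_mem' := ⟨fun f v => by simp, fun v _ => rfl⟩
  smul_mem' := by
    rintro a φ ⟨h1, h2⟩
    refine ⟨fun f v => ?_, fun v hv => ?_⟩
    · simp only [Pi.smul_apply, smul_eq_mul, h1]; ring
    · simp only [Pi.smul_apply, smul_eq_mul, h2 v hv, mul_zero]

/-- The element of `L^k` whose value on the frame `b` is `r`. -/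
def weightOfBasis {m : ℕ} (k : ℝ) {V : Type*} [AddCommGroup V] [Module ℝ V]
    (b : Module.Basis (Fin m) ℝ V) (r : ℝ) : weightSpace m k V :=
  open Classical in
  ⟨fun v => if LinearIndependent ℝ v then |b.det v| ^ (-k / m) * r else 0, by
    refine ⟨fun f v => ?_, fun v hv => if_neg hv⟩
    have hli : LinearIndependent ℝ (fun i => f (v i)) ↔ LinearIndependent ℝ v :=
      LinearMap.linearIndependent_iff_of_injOn (f : V →ₗ[ℝ] V) f.injective.injOn
    have hdet : b.det (fun i => f (v i)) = LinearMap.det (f : V →ₗ[ℝ] V) * b.det v :=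
      Module.Basis.det_comp b (f : V →ₗ[ℝ] V) v
    by_cases hv : LinearIndependent ℝ v
    · simp only [hli, hv, if_true, hdet, abs_mul,
        Real.mul_rpow (abs_nonneg _) (abs_nonneg _), mul_assoc]
    · simp only [hli, hv, if_false, mul_zero]⟩

/-- Sanity check: the element of `L^k` built from `b` and `r` takes the value `r` on `b`. -/
theorem weightOfBasis_apply {m : ℕ} (k : ℝ) {V : Type*} [AddCommGroup V] [Module ℝ V]
    (b : Module.Basis (Fin m) ℝ V) (r : ℝ) : (weightOfBasis k b r).1 b = r := by
  simp [weightOfBasis, b.linearIndependent, b.det_self]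

section Trace

variable {n : ℕ} {W A : Type*} [AddCommGroup A] [Module ℝ A]

/-- The trace `∑ g^{ij} B(w_i, w_j)` of `B` with respect to the scalar product `g`, computed in
the basis `w`. -/
def bilinTrace (g : W → W → ℝ) (w : Fin n → W) (B : W → W → A) : A :=
  ∑ i, ∑ j, ((Matrix.of fun a b => g (w a) (w b))⁻¹ i j) • B (w i) (w j)

/-- The trace-free part `B - (1/n) g · tr_g B`. It does not change when `g` is rescaled, so that
`g` may be any scalar product that represents a conformal class. -/
def traceFree (g : W → W → ℝ) (w : Fin n → W) (B : W → W → A) : W → W → A :=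
  fun X Y => B X Y - ((1 / (n : ℝ)) * g X Y) • bilinTrace g w B

/-- The symmetric part of `B`. -/
def symPart (B : W → W → A) : W → W → A := fun X Y => (1 / 2 : ℝ) • (B X Y + B Y X)

end Trace

/-! ### Conformal manifolds -/

/-- The model space of dimension `m`. -/
abbrev Model (m : ℕ) : Type := EuclideanSpace ℝ (Fin m)

variable {m n : ℕ}

section Ambient

variable {M : Type*} [TopologicalSpace M] [ChartedSpace (Model m) M]

/-- The coordinate basis of `T_x M` given by the preferred chart at `x`. -/
def coordBasis (x : M) : Module.Basis (Fin m) ℝ (TangentSpace (𝓡 m) x) :=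
  (EuclideanSpace.basisFun (Fin m) ℝ).toBasis

variable [IsManifold (𝓡 m) ∞ M]

/-- The coordinate vector fields of the preferred chart at `x`. -/
def coordFrame (x : M) (i : Fin m) (y : M) : TangentSpace (𝓡 m) y :=
  FiberBundle.extend (Model m) (coordBasis x i) y

/-- A section of `L^k` (over `M`, say) is smooth at `x` if its value on the coordinate frame
around `x` is a smooth function near `x`. -/
def SmoothWeightAt (k : ℝ) (l : ∀ x : M, weightSpace m k (TangentSpace (𝓡 m) x)) (x : M) : Prop :=
  ContMDiffAt (𝓡 m) 𝓘(ℝ, ℝ) ∞ (fun y => (l y).1 (fun i => coordFrame x i y)) x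

variable (m M) in
/-- A conformal structure: a smooth positive definite symmetric bilinear form `c` on `TM` with
values in `L²`, normalized by the condition that `|det c| : (Λ^m TM)² → L^{2m}` is the identity. -/
structure ConformalStructure where
  /-- The form `c`. -/
  form : ∀ x : M, TangentSpace (𝓡 m) x →ₗ[ℝ] TangentSpace (𝓡 m) x →ₗ[ℝ]
    weightSpace m 2 (TangentSpace (𝓡 m) x)
  symm : ∀ (x : M) (X Y : TangentSpace (𝓡 m) x), form x X Y = form x Y X
  pos : ∀ (x : M) (X : TangentSpace (𝓡 m) x), X ≠ 0 →
    ∀ v : Fin m → TangentSpace (𝓡 m) x, LinearIndependent ℝ v → 0 < (form x X X).1 v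
  normalized : ∀ (x : M) (v : Fin m → TangentSpace (𝓡 m) x), LinearIndependent ℝ v →
    |(Matrix.of fun i j => (form x (v i) (v j)).1 v).det| = 1
  smooth : ∀ (x : M) (i j : Fin m),
    SmoothWeightAt 2 (fun y => form y (coordFrame x i y) (coordFrame x j y)) x

/-- A scalar product on `T_x M` in the conformal class: the value of `c` on the coordinate basis
of `T_x M`. -/
def ConformalStructure.rep (c : ConformalStructure m M) (x : M)
    (X Y : TangentSpace (𝓡 m) x) : ℝ :=
  (c.form x X Y).1 (coordBasis x)

/-- The metric `g_l = l⁻² c` given by a section `l` of `L`. The quotient does not depend on the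
frame on which `c` and `l` are evaluated. -/
def ConformalStructure.metric (c : ConformalStructure m M)
    (l : ∀ x : M, weightSpace m 1 (TangentSpace (𝓡 m) x)) (x : M)
    (X Y : TangentSpace (𝓡 m) x) : ℝ :=
  (c.form x X Y).1 (coordBasis x) / ((l x).1 (coordBasis x)) ^ 2

variable (m M) in
/-- The type of the operators `∇` on vector fields; `D Y x X` is `∇_X Y` at the point `x`. -/
abbrev Conn : Type _ :=
  (∀ x : M, TangentSpace (𝓡 m) x) → ∀ x : M, TangentSpace (𝓡 m) x →L[ℝ] TangentSpace (𝓡 m) x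

/-- The trace of the connection matrix in the coordinate frame at `x`: if
`∇_X e_i = ∑ ω_i^j(X) e_j`, this is `∑ ω_i^i(X)`. -/
def connTrace (D : Conn m M) (x : M) (X : TangentSpace (𝓡 m) x) : ℝ :=
  ∑ i, (coordBasis x).coord i (D (coordFrame x i) x X)

/-- The connection induced by `∇` on `L^k`: in the coordinate frame `e` at `x`,
`(∇_X l)(e) = X(l(e)) + (k/m) tr ω(X) l(e)`. -/
def covWeight (k : ℝ) (D : Conn m M) (l : ∀ x : M, weightSpace m k (TangentSpace (𝓡 m) x))
    (x : M) (X : TangentSpace (𝓡 m) x) : weightSpace m k (TangentSpace (𝓡 m) x) :=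
  weightOfBasis k (coordBasis x)
    (mvfderiv (𝓡 m) (fun y => (l y).1 (fun i => coordFrame x i y)) x X
      + k / m * connTrace D x X * (l x).1 (coordBasis x))

/-- A Weyl structure: a smooth torsion-free connection on `TM` with `∇c = 0`. -/
structure WeylStructure (c : ConformalStructure m M) where
  /-- The connection. -/
  conn : CovariantDerivative (𝓡 m) (Model m) (TangentSpace (𝓡 m) : M → Type _)
  smooth : CovariantDerivative.ContMDiffCovariantDerivative conn ∞
  torsion_free : conn.torsion = 0
  conformal : ∀ (x : M) (X : TangentSpace (𝓡 m) x) (Y Z : ∀ y : M, TangentSpace (𝓡 m) y),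
    MDifferentiableAt (𝓡 m) (𝓡 m).tangent (fun y => (⟨y, Y y⟩ : TangentBundle (𝓡 m) M)) x →
    MDifferentiableAt (𝓡 m) (𝓡 m).tangent (fun y => (⟨y, Z y⟩ : TangentBundle (𝓡 m) M)) x →
    covWeight 2 conn (fun y => c.form y (Y y) (Z y)) x X =
      c.form x (conn Y x X) (Z x) + c.form x (Y x) (conn Z x X)

/-- The curvature `R_{X,Y} Z = ∇_X ∇_Y Z - ∇_Y ∇_X Z - ∇_{[X,Y]} Z`, computed by extending tangent
vectors to local vector fields. -/
def curvature (D : Conn m M) (x : M) (X Y Z : TangentSpace (𝓡 m) x) : TangentSpace (𝓡 m) x :=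
  let X' : ∀ y : M, TangentSpace (𝓡 m) y := FiberBundle.extend (Model m) X
  let Y' : ∀ y : M, TangentSpace (𝓡 m) y := FiberBundle.extend (Model m) Y
  let Z' : ∀ y : M, TangentSpace (𝓡 m) y := FiberBundle.extend (Model m) Z
  D (fun y => D Z' y (Y' y)) x X - D (fun y => D Z' y (X' y)) x Y
    - D Z' x (VectorField.mlieBracket (𝓡 m) X' Y' x)

/-- The Faraday form: the component along the identity of the curvature. -/
def faraday (D : Conn m M) (x : M) (X Y : TangentSpace (𝓡 m) x) : ℝ :=
  1 / (m : ℝ) * ∑ i, (coordBasis x).coord i (curvature D x X Y (coordBasis x i))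

/-- The Ricci tensor `Ric(X, Y) = tr (Z ↦ R_{Z,X} Y)`. -/
def ricci (D : Conn m M) (x : M) (X Y : TangentSpace (𝓡 m) x) : ℝ :=
  ∑ i, (coordBasis x).coord i (curvature D x (coordBasis x i) X Y)

/-- The Schouten-Weyl tensor
`h = (1/(m-2)) Ric^s_0 + (1/(2m(m-1))) tr_c(Ric) c - (1/2) F` (for `m ≥ 3`). -/
def schouten (c : ConformalStructure m M) (D : Conn m M) (x : M)
    (X Y : TangentSpace (𝓡 m) x) : ℝ :=
  1 / ((m : ℝ) - 2) * traceFree (c.rep x) (coordBasis x) (symPart (ricci D x)) X Y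
    + 1 / (2 * (m : ℝ) * ((m : ℝ) - 1))
      * bilinTrace (c.rep x) (coordBasis x) (ricci D x) * c.rep x X Y
    - 1 / 2 * faraday D x X Y

/-- The Hessian of a section `l` of `L`: `Hess(X, Y) l = ∇_X ∇_Y l - ∇_{∇_X Y} l`. -/
def hess (D : Conn m M) (l : ∀ x : M, weightSpace m 1 (TangentSpace (𝓡 m) x)) (x : M)
    (X Y : TangentSpace (𝓡 m) x) : weightSpace m 1 (TangentSpace (𝓡 m) x) :=
  let Y' : ∀ y : M, TangentSpace (𝓡 m) y := FiberBundle.extend (Model m) Y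
  covWeight 1 D (fun y => covWeight 1 D l y (Y' y)) x X - covWeight 1 D l x (D Y' x X)

/-- The canonical Möbius operator of `(M, c)`, computed with the Weyl structure `∇`:
`𝓜_{X,Y} l = Hess_0(X, Y) l + h^s_0(X, Y) l`, where both terms are the symmetric trace-free
parts. -/
def mobius (c : ConformalStructure m M) (D : WeylStructure c)
    (l : ∀ x : M, weightSpace m 1 (TangentSpace (𝓡 m) x)) (x : M)
    (X Y : TangentSpace (𝓡 m) x) : weightSpace m 1 (TangentSpace (𝓡 m) x) :=
  traceFree (c.rep x) (coordBasis x) (symPart (hess D.conn l x)) X Y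
    + traceFree (c.rep x) (coordBasis x) (symPart (schouten c D.conn x)) X Y • l x

end Ambient

/-! ### Submanifolds -/

section Submanifold

variable {M : Type*} [TopologicalSpace M] [ChartedSpace (Model m) M] [IsManifold (𝓡 m) ∞ M]
  {N : Type*} [TopologicalSpace N] [ChartedSpace (Model n) N] [IsManifold (𝓡 n) ∞ N]

variable (n) in
/-- The differential of `ι : N → M`. -/
abbrev dmap (ι : N → M) (p : N) : TangentSpace (𝓡 n) p →L[ℝ] TangentSpace (𝓡 m) (ι p) :=
  mfderiv (𝓡 n) (𝓡 m) ι p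

/-- The scalar product induced on `T_p N` by the representative of `c` at `ι p`. -/
def repN (c : ConformalStructure m M) (ι : N → M) (p : N) (X Y : TangentSpace (𝓡 n) p) : ℝ :=
  c.rep (ι p) (dmap n ι p X) (dmap n ι p Y)

/-- The tangential component `V^N` of a vector `V` of `T_{ι p} M`, as a vector of `T_p N`. -/
def tangPart (c : ConformalStructure m M) (ι : N → M) (p : N) (V : TangentSpace (𝓡 m) (ι p)) :
    TangentSpace (𝓡 n) p :=
  ∑ i, ∑ j, ((Matrix.of fun a b => repN c ι p (coordBasis (m := n) p a)
      (coordBasis (m := n) p b))⁻¹ i j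
    * c.rep (ι p) V (dmap n ι p (coordBasis (m := n) p j))) • coordBasis (m := n) p i

/-- `∇_X V` for a vector field `V` of `M` along `ι` and `X` tangent to `N`: if `V = ∑ a_i e_i` in
the coordinate frame `e` of `M` at `ι p`, this is `∑ X(a_i) e_i + ∑ a_i(p) ∇_{dι X} e_i`. -/
def covAlong (D : Conn m M) (ι : N → M) (V : ∀ q : N, TangentSpace (𝓡 m) (ι q)) (p : N)
    (X : TangentSpace (𝓡 n) p) : TangentSpace (𝓡 m) (ι p) :=
  (show TangentSpace (𝓡 m) (ι p) from
    mvfderiv (𝓡 n) (fun q => (trivializationAt (Model m) (TangentSpace (𝓡 m) : M → Type _) (ι p)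
      (⟨ι q, V q⟩ : TangentBundle (𝓡 m) M)).2) p X)
  + D (FiberBundle.extend (Model m) (V p)) (ι p) (dmap n ι p X)

/-- `∇_X l` for a section `l` of `L` over `N` and `X` tangent to `N`. -/
def covWeightAlong (D : Conn m M) (ι : N → M)
    (l : ∀ q : N, weightSpace m 1 (TangentSpace (𝓡 m) (ι q))) (p : N)
    (X : TangentSpace (𝓡 n) p) : weightSpace m 1 (TangentSpace (𝓡 m) (ι p)) :=
  weightOfBasis 1 (coordBasis (ι p))
    (mvfderiv (𝓡 n) (fun q => (l q).1 (fun i => coordFrame (ι p) i (ι q))) p X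
      + 1 / m * connTrace D (ι p) (dmap n ι p X) * (l p).1 (coordBasis (ι p)))

/-- `∇_X Y` along `N`, where `Y` is extended to a local vector field tangent to `N`. -/
def covTangent (D : Conn m M) (ι : N → M) (p : N) (X Y : TangentSpace (𝓡 n) p) :
    TangentSpace (𝓡 m) (ι p) :=
  covAlong D ι (fun q => dmap n ι q (FiberBundle.extend (Model n) Y q)) p X

/-- The fundamental form `B(X, Y) = (∇_X Y)^⊥` of `N` in `M`. -/
def fundForm (c : ConformalStructure m M) (D : Conn m M) (ι : N → M) (p : N)
    (X Y : TangentSpace (𝓡 n) p) : TangentSpace (𝓡 m) (ι p) :=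
  covTangent D ι p X Y - dmap n ι p (tangPart c ι p (covTangent D ι p X Y))

/-- The trace-free part `B_0` of the fundamental form. -/
def fundForm₀ (c : ConformalStructure m M) (D : Conn m M) (ι : N → M) (p : N) :
    TangentSpace (𝓡 n) p → TangentSpace (𝓡 n) p → TangentSpace (𝓡 m) (ι p) :=
  traceFree (repN (n := n) c ι p) (coordBasis (m := n) p) (fundForm c D ι p)

/-- The mean curvature `H`, as a linear form on normal vectors: `H(ξ) = (1/n) c(tr_c B, ξ)`, so
that `B = H · c + B_0`. It depends only on the conformal class of the scalar product. -/
def meanCurv (c : ConformalStructure m M) (D : Conn m M) (ι : N → M) (p : N)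
    (ξ : TangentSpace (𝓡 m) (ι p)) : ℝ :=
  1 / (n : ℝ) * c.rep (ι p) (bilinTrace (repN (n := n) c ι p) (coordBasis (m := n) p) (fundForm c D ι p)) ξ

/-- The horizontal Hessian of a section `l` of `L` over `N`:
`∇_X ∇_Y l - ∇_{(∇_X Y)^N} l`. -/
def hessBar (c : ConformalStructure m M) (D : Conn m M) (ι : N → M)
    (l : ∀ q : N, weightSpace m 1 (TangentSpace (𝓡 m) (ι q))) (p : N)
    (X Y : TangentSpace (𝓡 n) p) : weightSpace m 1 (TangentSpace (𝓡 m) (ι p)) :=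
  covWeightAlong (n := n) D ι (fun q => covWeightAlong (n := n) D ι l q (FiberBundle.extend (Model n) Y q)) p X
    - covWeightAlong (n := n) D ι l p (tangPart c ι p (covTangent D ι p X Y))

/-- The operator `P(X, Y) l`: horizontal Hessian plus the Schouten-Weyl tensor of `M`. -/
def opP (c : ConformalStructure m M) (D : Conn m M) (ι : N → M)
    (l : ∀ q : N, weightSpace m 1 (TangentSpace (𝓡 m) (ι q))) (p : N)
    (X Y : TangentSpace (𝓡 n) p) : weightSpace m 1 (TangentSpace (𝓡 m) (ι p)) :=
  hessBar c D ι l p X Y + schouten c D (ι p) (dmap n ι p X) (dmap n ι p Y) • l p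

/-- The induced Möbius operator of `N`, computed with the Weyl structure `∇` of `M`:
`𝓜^ind(X, Y) l = P_0(X, Y) l + H(B_0(X, Y)) l`. -/
def inducedMobius (c : ConformalStructure m M) (D : WeylStructure c) (ι : N → M)
    (l : ∀ q : N, weightSpace m 1 (TangentSpace (𝓡 m) (ι q))) (p : N)
    (X Y : TangentSpace (𝓡 n) p) : weightSpace m 1 (TangentSpace (𝓡 m) (ι p)) :=
  traceFree (repN (n := n) c ι p) (coordBasis (m := n) p) (opP c D.conn ι l p) X Y
    + meanCurv (n := n) c D.conn ι p (fundForm₀ c D.conn ι p X Y) • l p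

/-- `D` is the Levi-Civita connection, on the set `U`, of the metric `g`. -/
structure IsLeviCivitaOn (g : ∀ x : M, TangentSpace (𝓡 m) x → TangentSpace (𝓡 m) x → ℝ)
    (D : Conn m M) (U : Set M) : Prop where
  cov : IsCovariantDerivativeOn (Model m) D U
  torsion_free : ∀ x ∈ U, ∀ X Y : ∀ y : M, TangentSpace (𝓡 m) y,
    MDifferentiableAt (𝓡 m) (𝓡 m).tangent (fun y => (⟨y, X y⟩ : TangentBundle (𝓡 m) M)) x →
    MDifferentiableAt (𝓡 m) (𝓡 m).tangent (fun y => (⟨y, Y y⟩ : TangentBundle (𝓡 m) M)) x →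
    D Y x (X x) - D X x (Y x) = VectorField.mlieBracket (𝓡 m) X Y x
  metric : ∀ x ∈ U, ∀ (X : TangentSpace (𝓡 m) x) (Y Z : ∀ y : M, TangentSpace (𝓡 m) y),
    MDifferentiableAt (𝓡 m) (𝓡 m).tangent (fun y => (⟨y, Y y⟩ : TangentBundle (𝓡 m) M)) x →
    MDifferentiableAt (𝓡 m) (𝓡 m).tangent (fun y => (⟨y, Z y⟩ : TangentBundle (𝓡 m) M)) x →
    mvfderiv (𝓡 m) (fun y => g y (Y y) (Z y)) x X = g x (D Y x X) (Z x) + g x (Y x) (D Z x X)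

variable (n) in
/-- `N` is a minimal submanifold of `(U, g_l)`: its mean curvature with respect to the Levi-Civita
connection of the metric `g_l = l⁻² c` vanishes. -/
def IsMinimalFor (c : ConformalStructure m M) (ι : N → M) (U : Set M)
    (l : ∀ x : M, weightSpace m 1 (TangentSpace (𝓡 m) x)) : Prop :=
  ∃ D : Conn m M, IsLeviCivitaOn (c.metric l) D U ∧
    ∀ (p : N) (ξ : TangentSpace (𝓡 m) (ι p)), meanCurv (n := n) c D ι p ξ = 0

end Submanifold

end ConfGeom

end

open ConfGeom

/-!
Fix a point of `N` and let `T` be the linear form `ξ ↦ ∇_ξ l^min` on `TM` with values in `L`.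

*Restriction.* For `l = l^min|_N` the chain rule along `ι` gives
`∇_X ∇_Y l - ∇_{(∇_X Y)^N} l = Hess(X, Y) l^min + T(B(X, Y))` (`hessBar_eq`). The chain rule is
available because the connection on `L`, defined at each point through the coordinate frame of
that point, may be computed in any coordinate frame (`covWeight_apply_frame`). That rests on the
derivative of the determinant of the matrix relating two frames.

*Minimality.* Write `∇ l^min = γ ⊗ l^min`. Then `∇` minus the Levi-Civita connection of
`(l^min)⁻² c` is a symmetric tensor preserving the metric up to `2γ`, so the Koszul trick
determines it (`repForm_cov_sub`): its component along a normal vector `ξ` is `-γ(ξ) c`. Hence the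
mean curvature with respect to `∇` is `H(ξ) = -γ(ξ)`, that is, `H(ξ) l^min = -T(ξ)`
(`meanCurv_smul`). Therefore the trace-free part `T(B_0)` of `T(B)` cancels the term `H(B_0) l` of
the induced operator, and what remains is the trace-free part of `Hess l^min + h l^min` along `TN`.

*Symmetry.* The antisymmetric part of `Hess l^min` is half of the Faraday form (`hess_sub_hess`),
and it cancels the term `-F/2` of the Schouten-Weyl tensor. So `Hess l^min + h l^min` agrees with the
canonical Möbius operator up to multiples of `c`, which the trace-free part along `TN` ignores
(`exists_hess_add_schouten_eq`).

*Invariance.* Two Weyl structures differ by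
`A(X, Y) = γ(X) Y + γ(Y) X - c(X, Y) γ^♯` for a one-form `γ`. With `β = ∇γ`, modulo multiples of `c`
the Hessian changes by `β - γ ⊗ γ` (`exists_hess_diff`) and the symmetric part of the Ricci tensor
by `-(m - 2) (β^s - γ ⊗ γ)` (`exists_ricci_diff`); the two changes cancel in the Möbius operator
(`mobius_eq`).

A tangent vector at `x` is extended to a vector field that is constant in the chart at `x`; such
fields commute, depend linearly on the vector in the chart domain only, and are smooth there.
-/

namespace ConfGeom

open Topology

/-! ### Densities and frames -/

section Weights

variable {m : ℕ} {k : ℝ} {V : Type*} [AddCommGroup V] [Module ℝ V]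

/-- The transformation rule of a density under a change of basis. -/
theorem weightSpace_apply_basis (φ : weightSpace m k V) (b b' : Module.Basis (Fin m) ℝ V) :
    φ.1 b' = |b.det b'| ^ (-k / m) * φ.1 b := by
  have h := φ.2.1 (b.equiv b' (Equiv.refl _)) b
  have h2 : (fun i => (b.equiv b' (Equiv.refl _)) (b i)) = b' := by
    ext i; simp
  have h3 : b.det b' = LinearMap.det (b.equiv b' (Equiv.refl _) : V →ₗ[ℝ] V) := by
    have := Module.Basis.det_comp b (b.equiv b' (Equiv.refl _) : V →ₗ[ℝ] V) b
    rw [b.det_self, mul_one] at this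
    rw [← this]
    congr 1
    ext i; simp
  rw [h2] at h
  rw [h, h3]

theorem weightSpace_ext (b : Module.Basis (Fin m) ℝ V) {φ ψ : weightSpace m k V}
    (h : φ.1 b = ψ.1 b) : φ = ψ := by
  have := Module.Finite.of_basis b
  apply Subtype.ext
  funext v
  by_cases hv : LinearIndependent ℝ v
  · have hc : Fintype.card (Fin m) = Module.finrank ℝ V := by
      rw [Module.finrank_eq_card_basis b]
    set b' := basisOfLinearIndependentOfCardEqFinrank' v hv hc
    have hb' : v = b' := by simp [b']
    rw [hb', weightSpace_apply_basis φ b b', weightSpace_apply_basis ψ b b', h]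
  · rw [φ.2.2 v hv, ψ.2.2 v hv]

theorem weightSpace_apply_ne_zero (b : Module.Basis (Fin m) ℝ V) {φ : weightSpace m k V}
    (h : φ ≠ 0) : φ.1 b ≠ 0 :=
  fun h0 => h (weightSpace_ext b h0)

end Weights

section Frame

variable {m : ℕ} {M : Type*} [TopologicalSpace M] [ChartedSpace (Model m) M]
  [IsManifold (𝓡 m) ∞ M]

/-- The extension of a tangent vector at `x` has constant components in the chart at `x`. -/
theorem extend_eq_symm {x : M} (v : TangentSpace (𝓡 m) x) (y : M) :
    FiberBundle.extend (Model m) v y =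
      (trivializationAt (Model m) (TangentSpace (𝓡 m) : M → Type _) x).symm y v := by
  unfold FiberBundle.extend
  congr 1
  rw [TangentBundle.trivializationAt_apply]
  exact tangentCoordChange_self (I := 𝓡 m) (x := x) (z := x) (v := v) (mem_extChartAt_source x)

/-- The coordinate frame of the chart at `x`, as a basis of `T_y M`. -/
noncomputable def frameBasis (x y : M) (hy : y ∈ (chartAt (Model m) x).source) :
    Module.Basis (Fin m) ℝ (TangentSpace (𝓡 m) y) :=
  (EuclideanSpace.basisFun (Fin m) ℝ).toBasis.map
    ((trivializationAt (Model m) (TangentSpace (𝓡 m) : M → Type _) x).linearEquivAt ℝ y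
      (by simpa using hy)).symm

theorem frameBasis_apply (x y : M) (hy : y ∈ (chartAt (Model m) x).source) (i : Fin m) :
    frameBasis x y hy i = coordFrame x i y := by
  rw [coordFrame, extend_eq_symm]
  rfl

theorem coe_frameBasis (x y : M) (hy : y ∈ (chartAt (Model m) x).source) :
    (frameBasis x y hy : Fin m → TangentSpace (𝓡 m) y) = fun i => coordFrame x i y :=
  funext (frameBasis_apply x y hy)

theorem coordFrame_self (x : M) (i : Fin m) : coordFrame x i x = coordBasis x i := by
  simp [coordFrame]

theorem coe_coordBasis (x : M) :
    (coordBasis x : Fin m → TangentSpace (𝓡 m) x) = fun i => coordFrame x i x := by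
  ext1 i; rw [coordFrame_self]

/-- The value at `y` of the extension of tangent vectors at `x` which is constant in the chart
at `x`, as a linear map. -/
noncomputable def extendₗ (x y : M) (hy : y ∈ (chartAt (Model m) x).source) :
    TangentSpace (𝓡 m) x →ₗ[ℝ] TangentSpace (𝓡 m) y :=
  ((trivializationAt (Model m) (TangentSpace (𝓡 m) : M → Type _) x).linearEquivAt ℝ y
      (by simpa using hy)).symm.toLinearMap

theorem extendₗ_apply (x y : M) (hy : y ∈ (chartAt (Model m) x).source)
    (v : TangentSpace (𝓡 m) x) : extendₗ x y hy v = FiberBundle.extend (Model m) v y := by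
  rw [extend_eq_symm]; rfl

theorem extend_eq_sum {x y : M} (hy : y ∈ (chartAt (Model m) x).source)
    (v : TangentSpace (𝓡 m) x) :
    (FiberBundle.extend (Model m) v y : TangentSpace (𝓡 m) y) =
      ∑ i, (coordBasis x).coord i v • coordFrame x i y := by
  rw [← extendₗ_apply x y hy]
  conv_lhs => rw [← (coordBasis x).sum_repr v]
  simp only [map_sum, map_smul, extendₗ_apply]
  rfl

omit [IsManifold (𝓡 m) ∞ M] in
theorem chart_source_eventually (x : M) : ∀ᶠ y in 𝓝 x, y ∈ (chartAt (Model m) x).source :=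
  (chartAt (Model m) x).open_source.mem_nhds (mem_chart_source _ x)

theorem contMDiffOn_extend {x : M} (v : TangentSpace (𝓡 m) x) :
    ContMDiffOn (𝓡 m) (𝓡 m).tangent ∞
      (fun y => (⟨y, FiberBundle.extend (Model m) v y⟩ : TangentBundle (𝓡 m) M))
      (chartAt (Model m) x).source := by
  set t := trivializationAt (Model m) (TangentSpace (𝓡 m) : M → Type _) x
  have hb : t.baseSet = (chartAt (Model m) x).source := TangentBundle.trivializationAt_baseSet x
  rw [← hb]
  suffices ContMDiffOn (𝓡 m) 𝓘(ℝ, Model m) ∞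
      (fun y => (t ⟨y, FiberBundle.extend (Model m) v y⟩).2) t.baseSet by
    intro y hy
    rw [t.contMDiffWithinAt_section _ hy]
    exact this y hy
  have : ContMDiffOn (𝓡 m) 𝓘(ℝ, Model m) ∞ (fun _ : M => (t ⟨x, v⟩).2) t.baseSet :=
    contMDiffOn_const
  refine this.congr fun y hy ↦ ?_
  have := congrArg Prod.snd (t.apply_mk_symm hy (t ⟨x, v⟩).2)
  exact this

theorem contMDiffAt_extend_of_mem {x y : M} (v : TangentSpace (𝓡 m) x)
    (hy : y ∈ (chartAt (Model m) x).source) :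
    ContMDiffAt (𝓡 m) (𝓡 m).tangent ∞
      (fun y => (⟨y, FiberBundle.extend (Model m) v y⟩ : TangentBundle (𝓡 m) M)) y :=
  (contMDiffOn_extend v).contMDiffAt ((chartAt (Model m) x).open_source.mem_nhds hy)

theorem mdifferentiableAt_extend_of_mem {x y : M} (v : TangentSpace (𝓡 m) x)
    (hy : y ∈ (chartAt (Model m) x).source) :
    MDifferentiableAt (𝓡 m) (𝓡 m).tangent
      (fun y => (⟨y, FiberBundle.extend (Model m) v y⟩ : TangentBundle (𝓡 m) M)) y :=
  (contMDiffAt_extend_of_mem v hy).mdifferentiableAt (by simp)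

/-- The components of a vector field in the coordinate frame at `x`. -/
noncomputable def frameCoord (x : M) (i : Fin m) (V : ∀ y : M, TangentSpace (𝓡 m) y) (y : M) : ℝ :=
  ((trivializationAt (Model m) (TangentSpace (𝓡 m) : M → Type _) x ⟨y, V y⟩).2 : Model m) i

theorem mdifferentiableAt_frameCoord {x y : M} (hy : y ∈ (chartAt (Model m) x).source)
    {V : ∀ y : M, TangentSpace (𝓡 m) y}
    (hV : MDifferentiableAt (𝓡 m) (𝓡 m).tangent
      (fun y => (⟨y, V y⟩ : TangentBundle (𝓡 m) M)) y) (i : Fin m) :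
    MDifferentiableAt (𝓡 m) 𝓘(ℝ, ℝ) (frameCoord x i V) y := by
  have hb : y ∈ (trivializationAt (Model m) (TangentSpace (𝓡 m) : M → Type _) x).baseSet := by
    simpa using hy
  have h := (Bundle.Trivialization.mdifferentiableAt_section_iff (e := trivializationAt (Model m)
    (TangentSpace (𝓡 m) : M → Type _) x) (IB := 𝓡 m) V hb).1 hV
  exact ((EuclideanSpace.proj i : Model m →L[ℝ] ℝ).differentiableAt.mdifferentiableAt.comp _ h)

theorem eq_sum_frameCoord {x y : M} (hy : y ∈ (chartAt (Model m) x).source)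
    (V : ∀ y : M, TangentSpace (𝓡 m) y) :
    V y = ∑ i, frameCoord x i V y • coordFrame x i y := by
  conv_lhs => rw [← (frameBasis x y hy).sum_repr (V y)]
  refine Finset.sum_congr rfl fun i _ => ?_
  rw [frameBasis_apply]
  rfl

theorem frameBasis_coord {x y : M} (hy : y ∈ (chartAt (Model m) x).source)
    (V : ∀ y : M, TangentSpace (𝓡 m) y) (i : Fin m) :
    (frameBasis x y hy).coord i (V y) = frameCoord x i V y := rfl

end Frame

/-! ### The derivative of a determinant -/

section Det

variable {m : ℕ}

/-- The entry `(i, j)` as a linear form on matrices. -/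
noncomputable def matrixEntry (i j : Fin m) : (Fin m → Fin m → ℝ) →L[ℝ] ℝ :=
  (ContinuousLinearMap.proj (R := ℝ) (φ := fun _ : Fin m => ℝ) j).comp
    (ContinuousLinearMap.proj (R := ℝ) (φ := fun _ : Fin m => Fin m → ℝ) i)

/-- Jacobi's formula for the derivative of the determinant. -/
theorem hasFDerivAt_det (A : Fin m → Fin m → ℝ) :
    ∃ L : (Fin m → Fin m → ℝ) →L[ℝ] ℝ,
      HasFDerivAt (fun B : Fin m → Fin m → ℝ => Matrix.det (Matrix.of B)) L A ∧
      ∀ B, L B = ((Matrix.of A).adjugate * Matrix.of B).trace := by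
  have hentry : ∀ i j, HasFDerivAt (fun B : Fin m → Fin m → ℝ => B i j) (matrixEntry i j) A :=
    fun i j => (matrixEntry i j).hasFDerivAt
  refine ⟨∑ σ : Equiv.Perm (Fin m), ((Equiv.Perm.sign σ : ℤ) : ℝ) • ∑ i,
    (∏ j ∈ Finset.univ.erase i, A (σ j) j) • matrixEntry (σ i) i, ?_, fun B => ?_⟩
  · have h : (fun B : Fin m → Fin m → ℝ => Matrix.det (Matrix.of B)) =
        fun B => ∑ σ : Equiv.Perm (Fin m), ((Equiv.Perm.sign σ : ℤ) : ℝ) * ∏ i, B (σ i) i := by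
      funext B; rw [Matrix.det_apply']; rfl
    rw [h]
    refine HasFDerivAt.fun_sum fun σ _ => ?_
    exact (HasFDerivAt.finsetProd fun i _ => hentry (σ i) i).const_mul _
  · have h1 : ((Matrix.of A).adjugate * Matrix.of B).trace =
        ∑ i, Matrix.det ((Matrix.of A).updateCol i (fun j => B j i)) := by
      rw [Matrix.trace]
      refine Finset.sum_congr rfl fun i _ => ?_
      rw [Matrix.diag_apply, ← Matrix.cramer_apply, Matrix.cramer_eq_adjugate_mulVec]
      rfl
    rw [h1]
    simp only [Matrix.det_apply', sum_apply, smul_apply,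
      smul_eq_mul, Finset.mul_sum]
    rw [Finset.sum_comm]
    refine Finset.sum_congr rfl fun i _ => Finset.sum_congr rfl fun σ _ => ?_
    congr 1
    rw [← Finset.mul_prod_erase _ _ (Finset.mem_univ i), mul_comm]
    simp only [Matrix.updateCol_self]
    congr 1
    refine Finset.prod_congr rfl fun j hj => ?_
    rw [Matrix.updateCol_ne (Finset.ne_of_mem_erase hj), Matrix.of_apply]

end Det

/-! ### Derivatives and the induced connection on densities -/

section Calculus

variable {E H M : Type*} [NormedAddCommGroup E] [NormedSpace ℝ E] [TopologicalSpace H]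
  {I : ModelWithCorners ℝ E H} [TopologicalSpace M] [ChartedSpace H M]
  {F G : Type*} [NormedAddCommGroup F] [NormedSpace ℝ F] [NormedAddCommGroup G] [NormedSpace ℝ G]

theorem mdifferentiableAt_comp_of_hasFDerivAt {f : M → F} {g : F → G} {L : F →L[ℝ] G} {y : M}
    (hg : HasFDerivAt g L (f y)) (hf : MDifferentiableAt I 𝓘(ℝ, F) f y) :
    MDifferentiableAt I 𝓘(ℝ, G) (fun z => g (f z)) y :=
  hg.differentiableAt.mdifferentiableAt.comp y hf

theorem mvfderiv_comp_of_hasFDerivAt {f : M → F} {g : F → G} {L : F →L[ℝ] G} {y : M}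
    (hg : HasFDerivAt g L (f y)) (hf : MDifferentiableAt I 𝓘(ℝ, F) f y) (V : TangentSpace I y) :
    mvfderiv I (fun z => g (f z)) y V = L (mvfderiv I f y V) := by
  have h := (hg.hasMFDerivAt.comp y hf.hasMFDerivAt).mfderiv
  have h2 : mfderiv I 𝓘(ℝ, G) (fun z => g (f z)) y = _ := h
  unfold mvfderiv
  rw [h2]
  rfl

theorem mvfderiv_congr {f g : M → F} {y : M} (h : f =ᶠ[𝓝 y] g) :
    mvfderiv I f y = mvfderiv I g y := by
  unfold mvfderiv
  ext V
  have := h.mfderiv_eq (I := I) (I' := 𝓘(ℝ, F))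
  change (mfderiv I 𝓘(ℝ, F) f y) V = (mfderiv I 𝓘(ℝ, F) g y) V
  rw [this]
  rfl

theorem mvfderiv_sum {ι : Type*} (s : Finset ι) {f : ι → M → F} {y : M}
    (hf : ∀ i ∈ s, MDifferentiableAt I 𝓘(ℝ, F) (f i) y) (V : TangentSpace I y) :
    mvfderiv I (fun z => ∑ i ∈ s, f i z) y V = ∑ i ∈ s, mvfderiv I (f i) y V ∧
    MDifferentiableAt I 𝓘(ℝ, F) (fun z => ∑ i ∈ s, f i z) y := by
  classical
  induction s using Finset.induction_on with
  | empty => simp [mvfderiv_const, mdifferentiableAt_const]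
  | insert a s ha ih =>
    have ih := ih fun i hi => hf i (Finset.mem_insert_of_mem hi)
    simp only [Finset.sum_insert ha]
    refine ⟨?_, (hf a (Finset.mem_insert_self _ _)).add ih.2⟩
    rw [mvfderiv_fun_add (hf a (Finset.mem_insert_self _ _)) ih.2, add_apply,
      ih.1]

end Calculus

section FrameChange

variable {m : ℕ} {M : Type*} [TopologicalSpace M] [ChartedSpace (Model m) M]
  [IsManifold (𝓡 m) ∞ M]

/-- The Leibniz rule for a linear combination of vector fields with function coefficients, and the
differentiability of the combination. -/
theorem cov_sum {D : Conn m M} {U : Set M} (hD : IsCovariantDerivativeOn (Model m) D U)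
    {ι : Type*} (s : Finset ι) {f : ι → M → ℝ} {σ : ι → ∀ y : M, TangentSpace (𝓡 m) y} {y : M}
    (hy : y ∈ U) (hf : ∀ i, MDifferentiableAt (𝓡 m) 𝓘(ℝ, ℝ) (f i) y)
    (hσ : ∀ i, MDifferentiableAt (𝓡 m) (𝓡 m).tangent
      (fun z => (⟨z, σ i z⟩ : TangentBundle (𝓡 m) M)) y) (V : TangentSpace (𝓡 m) y) :
    D (fun z => ∑ i ∈ s, f i z • σ i z) y V =
      ∑ i ∈ s, (f i y • D (σ i) y V + mvfderiv (𝓡 m) (f i) y V • σ i y) ∧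
    MDifferentiableAt (𝓡 m) (𝓡 m).tangent
      (fun z => (⟨z, ∑ i ∈ s, f i z • σ i z⟩ : TangentBundle (𝓡 m) M)) y := by
  classical
  induction s using Finset.induction_on with
  | empty =>
    simp only [Finset.sum_empty]
    refine ⟨?_, mdifferentiableAt_zeroSection ..⟩
    have := hD.zero hy
    change D 0 y V = 0
    rw [this]; rfl
  | insert a s ha ih =>
    simp only [Finset.sum_insert ha]
    have h1 : MDifferentiableAt (𝓡 m) (𝓡 m).tangent
      (fun z => (⟨z, f a z • σ a z⟩ : TangentBundle (𝓡 m) M)) y := (hf a).smul_section (hσ a)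
    refine ⟨?_, mdifferentiableAt_add_section h1 ih.2⟩
    have h2 := hD.add h1 ih.2 hy
    have h3 := hD.leibniz (hσ a) (hf a) hy
    change D ((fun z => f a z • σ a z) + fun z => ∑ i ∈ s, f i z • σ i z) y V = _
    rw [h2, add_apply, ih.1]
    congr 1
    change D (f a • σ a) y V = _
    rw [h3]
    rfl

/-- The trace of the matrix of the connection at `y` in the coordinate frame of the chart at `x`. -/
noncomputable def frameTrace (D : Conn m M) (x y : M) (hy : y ∈ (chartAt (Model m) x).source)
    (V : TangentSpace (𝓡 m) y) : ℝ :=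
  ∑ i, (frameBasis x y hy).coord i (D (coordFrame x i) y V)

theorem sum_coord_eq_trace {V : Type*} [AddCommGroup V] [Module ℝ V]
    (b : Module.Basis (Fin m) ℝ V) (T : V →ₗ[ℝ] V) :
    ∑ i, b.coord i (T (b i)) = LinearMap.trace ℝ V T := by
  rw [LinearMap.trace_eq_matrix_trace ℝ b, Matrix.trace]
  refine Finset.sum_congr rfl fun i _ => ?_
  rw [Matrix.diag_apply, LinearMap.toMatrix_apply, Module.Basis.coord_apply]

theorem hasDerivAt_abs_rpow {t : ℝ} (ht : t ≠ 0) (p : ℝ) :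
    HasDerivAt (fun s : ℝ => |s| ^ p) (p * |t| ^ p / t) t := by
  have h := (hasDerivAt_abs ht).rpow_const (p := p) (Or.inl (abs_ne_zero.2 ht))
  convert h using 1
  rw [Real.rpow_sub_one (abs_ne_zero.2 ht)]
  rcases lt_or_gt_of_ne ht with h0 | h0
  · rw [abs_of_neg h0, sign_neg h0]
    simp only [SignType.coe_neg_one]
    field_simp
  · rw [abs_of_pos h0, sign_pos h0]
    simp only [SignType.coe_one]
    field_simp

/-- The connection induced on `L^k`, defined at `y` in the coordinate frame at `y`, may be computed
in the coordinate frame at `x`: by Jacobi's formula, the derivative of the power of the determinant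
of the transition matrix is the change of the trace of the connection matrix. -/
theorem covWeight_apply_frame
    (D : CovariantDerivative (𝓡 m) (Model m) (TangentSpace (𝓡 m) : M → Type _))
    (k : ℝ) (l : ∀ x : M, weightSpace m k (TangentSpace (𝓡 m) x)) (x y : M)
    (hy : y ∈ (chartAt (Model m) x).source)
    (hl : MDifferentiableAt (𝓡 m) 𝓘(ℝ, ℝ) (fun z => (l z).1 (fun i => coordFrame y i z)) y)
    (V : TangentSpace (𝓡 m) y) :
    (covWeight k D l y V).1 (fun i => coordFrame x i y) =
      mvfderiv (𝓡 m) (fun z => (l z).1 (fun i => coordFrame x i z)) y V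
        + k / m * frameTrace D x y hy V * (l y).1 (fun i => coordFrame x i y) := by
  set B : M → Fin m → Fin m → ℝ := fun z j i => frameCoord y j (coordFrame x i) z
  have hyy : y ∈ (chartAt (Model m) y).source := mem_chart_source _ y
  have hx : ∀ i, MDifferentiableAt (𝓡 m) (𝓡 m).tangent
      (fun z => (⟨z, coordFrame x i z⟩ : TangentBundle (𝓡 m) M)) y := fun i =>
    mdifferentiableAt_extend_of_mem _ hy
  have hyf : ∀ i, MDifferentiableAt (𝓡 m) (𝓡 m).tangent
      (fun z => (⟨z, coordFrame y i z⟩ : TangentBundle (𝓡 m) M)) y := fun i =>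
    mdifferentiableAt_extend_of_mem _ hyy
  have hBe : ∀ i j, MDifferentiableAt (𝓡 m) 𝓘(ℝ, ℝ) (fun z => B z j i) y := fun i j =>
    mdifferentiableAt_frameCoord hyy (hx i) j
  have hBd : MDifferentiableAt (𝓡 m) 𝓘(ℝ, Fin m → Fin m → ℝ) B y := by
    have h : B = fun z => ∑ j, ∑ i, B z j i • (Pi.single j (Pi.single i 1) : Fin m → Fin m → ℝ) := by
      funext z j i
      simp [Finset.sum_apply, Pi.single_apply, apply_ite, ite_apply]
    rw [h]
    refine (mvfderiv_sum _ (fun j _ => (mvfderiv_sum _ (fun i _ => ?_) V).2) V).2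
    exact (hBe i j).smul mdifferentiableAt_const
  have hdB : ∀ i j, mvfderiv (𝓡 m) (fun z => B z j i) y V = (mvfderiv (𝓡 m) B y V) j i :=
    fun i j => mvfderiv_comp_of_hasFDerivAt (matrixEntry j i).hasFDerivAt hBd V
  -- the matrix of the frame at `x` with respect to the frame at `y`
  have hBdet : ∀ z (hz : z ∈ (chartAt (Model m) y).source),
      (frameBasis y z hz).det (fun i => coordFrame x i z) = Matrix.det (Matrix.of (B z)) := by
    intro z hz
    rw [Module.Basis.det_apply]
    rfl
  set b := frameBasis x y hy
  set e := frameBasis y y hyy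
  have hbv : ∀ i, b i = coordFrame x i y := frameBasis_apply x y hy
  have hev : ∀ i, e i = coordFrame y i y := frameBasis_apply y y hyy
  have hBy : Matrix.of (B y) = e.toMatrix b := by
    ext j i
    rw [Module.Basis.toMatrix_apply, hbv]; rfl
  have hPB : b.toMatrix e * Matrix.of (B y) = 1 := by
    rw [hBy]; exact Module.Basis.toMatrix_mul_toMatrix_flip _ _
  have hdet : Matrix.det (Matrix.of (B y)) ≠ 0 := by
    intro h0
    have := congrArg Matrix.det hPB
    rw [Matrix.det_mul, h0] at this
    simp at this
  have hadj : (Matrix.of (B y)).adjugate = Matrix.det (Matrix.of (B y)) • b.toMatrix e := by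
    have h1 := congrArg (b.toMatrix e * ·) (Matrix.mul_adjugate (Matrix.of (B y)))
    simp only [← Matrix.mul_assoc, hPB, Matrix.one_mul] at h1
    rw [h1, Matrix.mul_smul, Matrix.mul_one]
  obtain ⟨L, hL, hLt⟩ := hasFDerivAt_det (B y)
  have hd1 : MDifferentiableAt (𝓡 m) 𝓘(ℝ, ℝ) (fun z => Matrix.det (Matrix.of (B z))) y :=
    mdifferentiableAt_comp_of_hasFDerivAt (f := B) (g := fun C => Matrix.det (Matrix.of C)) hL hBd
  have hd2 : mvfderiv (𝓡 m) (fun z => Matrix.det (Matrix.of (B z))) y V =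
      Matrix.det (Matrix.of (B y)) * (b.toMatrix e * Matrix.of (mvfderiv (𝓡 m) B y V)).trace := by
    rw [mvfderiv_comp_of_hasFDerivAt (f := B) (g := fun C => Matrix.det (Matrix.of C))
      hL hBd, hLt, hadj, Matrix.smul_mul, Matrix.trace_smul]
    rfl
  have hp := (hasDerivAt_abs_rpow hdet (-k / m)).hasFDerivAt
  have hp1 := mdifferentiableAt_comp_of_hasFDerivAt (f := fun z => Matrix.det (Matrix.of (B z)))
    (g := fun s : ℝ => |s| ^ (-k / m : ℝ)) hp hd1
  have hp2 := mvfderiv_comp_of_hasFDerivAt (f := fun z => Matrix.det (Matrix.of (B z)))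
    (g := fun s : ℝ => |s| ^ (-k / m : ℝ)) hp hd1 V
  -- the density in the two frames
  have hlz : (fun z => (l z).1 (fun i => coordFrame x i z)) =ᶠ[𝓝 y]
      fun z => |Matrix.det (Matrix.of (B z))| ^ (-k / m) * (l z).1 (fun i => coordFrame y i z) := by
    filter_upwards [(chartAt (Model m) x).open_source.mem_nhds hy, chart_source_eventually (m := m) y]
      with z hz hz'
    have := weightSpace_apply_basis (l z) (frameBasis y z hz') (frameBasis x z hz)
    rw [coe_frameBasis, coe_frameBasis, hBdet z hz'] at this
    exact this
  have hly : (l y).1 (fun i => coordFrame x i y) = |Matrix.det (Matrix.of (B y))| ^ (-k / m) *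
      (l y).1 (fun i => coordFrame y i y) := hlz.self_of_nhds
  -- the trace of the connection in the two frames
  have hD : ∀ i, D (coordFrame x i) y V =
      ∑ j, (B y j i • D (coordFrame y j) y V + (mvfderiv (𝓡 m) B y V) j i • e j) := by
    intro i
    have h1 := cov_sum D.isCovariantDerivativeOnUniv Finset.univ (f := fun j z => B z j i)
      (σ := coordFrame y) (Set.mem_univ y) (hBe i) hyf V
    have h2 : D (coordFrame x i) y = D (fun z => ∑ j, B z j i • coordFrame y j z) y := by
      refine D.isCovariantDerivativeOnUniv.congr_of_eventuallyEq (hx i) h1.2 Filter.univ_mem ?_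
      filter_upwards [chart_source_eventually (m := m) y] with z hz
      exact eq_sum_frameCoord hz _
    rw [h2, h1.1]
    simp only [hdB, hev]
  set Ω : TangentSpace (𝓡 m) y →ₗ[ℝ] TangentSpace (𝓡 m) y :=
    e.constr ℝ fun j => D (coordFrame y j) y V
  have hΩe : ∀ j, Ω (e j) = D (coordFrame y j) y V := fun j => e.constr_basis ℝ _ j
  have hΩb : ∀ i, Ω (b i) = ∑ j, B y j i • D (coordFrame y j) y V := by
    intro i
    rw [hbv, eq_sum_frameCoord hyy (coordFrame x i), map_sum]
    refine Finset.sum_congr rfl fun j _ => ?_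
    rw [map_smul, ← hev, hΩe]
  have htr : frameTrace D x y hy V = connTrace D y V +
      (b.toMatrix e * Matrix.of (mvfderiv (𝓡 m) B y V)).trace := by
    have h1 : connTrace D y V = LinearMap.trace ℝ _ Ω := by
      rw [← sum_coord_eq_trace e]
      refine Finset.sum_congr rfl fun j _ => ?_
      rw [hΩe]
      have : e = coordBasis y := Module.Basis.eq_of_apply_eq fun i => by
        rw [hev, coordFrame_self]
      rw [this]
    rw [h1, ← sum_coord_eq_trace b, frameTrace, Matrix.trace, ← Finset.sum_add_distrib]
    refine Finset.sum_congr rfl fun i _ => ?_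
    rw [hD i, Finset.sum_add_distrib, map_add, hΩb]
    congr 1
    rw [map_sum, Matrix.diag_apply, Matrix.mul_apply]
    refine Finset.sum_congr rfl fun j _ => ?_
    rw [map_smul, smul_eq_mul, mul_comm]
    rfl
  -- comparison
  have hlhs := weightSpace_apply_basis (covWeight k D l y V) e b
  have hce : (e : Fin m → TangentSpace (𝓡 m) y) = coordBasis y := by
    funext i; rw [hev, coordFrame_self]
  have hcb : (b : Fin m → TangentSpace (𝓡 m) y) = fun i => coordFrame x i y := coe_frameBasis x y hy
  rw [hcb] at hlhs
  rw [hlhs, hBdet y hyy, hce, covWeight, weightOfBasis_apply, mvfderiv_congr hlz,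
    mvfderiv_fun_mul hp1 hl, htr, hly]
  simp only [add_apply, smul_apply, hp2, hd2,
    coe_coordBasis, smul_eq_mul, ContinuousLinearMap.toSpanSingleton_apply]
  field_simp
  ring

end FrameChange

/-! ### Coordinate vector fields -/

section Coordinates

variable {m : ℕ} {M : Type*} [TopologicalSpace M] [ChartedSpace (Model m) M]
  [IsManifold (𝓡 m) ∞ M]

/-- Smoothness of a covariant derivative is a condition on globally smooth vector fields, so the
local extension of a vector is cut off by a bump function. -/
theorem exists_contMDiff_eventuallyEq_extend [T2Space M] {x : M} (v : TangentSpace (𝓡 m) x) :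
    ∃ V : ∀ y : M, TangentSpace (𝓡 m) y,
      ContMDiff (𝓡 m) (𝓡 m).tangent ∞ (fun y => (⟨y, V y⟩ : TangentBundle (𝓡 m) M)) ∧
      ∀ᶠ y in 𝓝 x, V y = FiberBundle.extend (Model m) v y := by
  obtain ⟨ψ⟩ : Nonempty (SmoothBumpFunction (𝓡 m) x) := inferInstance
  refine ⟨fun y => ψ y • FiberBundle.extend (Model m) v y, ?_, ?_⟩
  · exact ContMDiffOn.smul_section_of_tsupport (u := (chartAt (Model m) x).source)
      ψ.contMDiff.contMDiffOn (chartAt (Model m) x).open_source ψ.tsupport_subset_chartAt_source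
      (contMDiffOn_extend v)
  · filter_upwards [ψ.eventuallyEq_one] with y hy
    rw [hy]; exact one_smul _ _

theorem mdifferentiableAt_cov_extend [T2Space M]
    (D : CovariantDerivative (𝓡 m) (Model m) (TangentSpace (𝓡 m) : M → Type _))
    (hD : CovariantDerivative.ContMDiffCovariantDerivative D ∞) {x : M}
    (v w : TangentSpace (𝓡 m) x) :
    MDifferentiableAt (𝓡 m) (𝓡 m).tangent
      (fun y => (⟨y, D (FiberBundle.extend (Model m) v) y (FiberBundle.extend (Model m) w y)⟩ :
        TangentBundle (𝓡 m) M)) x := by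
  obtain ⟨V, hV, hVx⟩ := exists_contMDiff_eventuallyEq_extend v
  have h1 := (hD.contMDiff.contMDiff (σ := V) (by simpa using hV.contMDiffOn)).contMDiffAt
    (Filter.univ_mem (f := 𝓝 x))
  have h2 := (h1.clm_bundle_apply (contMDiffAt_extend_of_mem w (mem_chart_source _ x))).mdifferentiableAt
    (by simp)
  refine h2.congr_of_eventuallyEq ?_
  filter_upwards [hVx.eventually_nhds, chart_source_eventually (m := m) x] with y hy hys
  have h3 : D (FiberBundle.extend (Model m) v) y = D V y :=
    D.isCovariantDerivativeOnUniv.congr_of_eventuallyEq (mdifferentiableAt_extend_of_mem v hys)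
      ((hV y).mdifferentiableAt (by simp)) Filter.univ_mem (hy.mono fun z hz => hz.symm)
  rw [h3]

theorem mfderiv_extChartAt_extend {x y : M} (v : TangentSpace (𝓡 m) x)
    (hy : y ∈ (chartAt (Model m) x).source) :
    mfderiv (𝓡 m) 𝓘(ℝ, Model m) (extChartAt (𝓡 m) x) y (FiberBundle.extend (Model m) v y) =
      (v : Model m) := by
  have h1 := TangentBundle.continuousLinearMapAt_trivializationAt (I := 𝓡 m) hy
  have hb : y ∈ (trivializationAt (Model m) (TangentSpace (𝓡 m) : M → Type _) x).baseSet := by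
    simpa using hy
  have h2 := Bundle.Trivialization.continuousLinearMapAt_symmL (R := ℝ) _ hb v
  have h3 := (Bundle.Trivialization.symmL_apply (R := ℝ) _ hb (v : Model m)).trans
    (extend_eq_symm v y).symm
  erw [h3] at h2
  exact (congrArg (fun T : TangentSpace (𝓡 m) y →L[ℝ] Model m =>
    T (FiberBundle.extend (Model m) v y)) h1.symm).trans h2

/-- The derivative of a function along a coordinate vector field, in the chart. -/
theorem mvfderiv_extend_eventuallyEq {f : M → ℝ} {x : M}
    (hf : ContMDiffAt (𝓡 m) 𝓘(ℝ, ℝ) ∞ f x) (v : TangentSpace (𝓡 m) x) :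
    (fun y => mvfderiv (𝓡 m) f y (FiberBundle.extend (Model m) v y)) =ᶠ[𝓝 x]
      fun y => fderiv ℝ (f ∘ (extChartAt (𝓡 m) x).symm) (extChartAt (𝓡 m) x y) (v : Model m) := by
  have hfc : ContDiffAt ℝ ∞ (f ∘ (extChartAt (𝓡 m) x).symm) (extChartAt (𝓡 m) x x) := by
    simpa [contMDiffAt_iff, contDiffWithinAt_univ] using! (contMDiffAt_iff.1 hf).2
  have hd : ∀ᶠ z in 𝓝 (extChartAt (𝓡 m) x x),
      DifferentiableAt ℝ (f ∘ (extChartAt (𝓡 m) x).symm) z := by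
    filter_upwards [(hfc.of_le (m := 1) (by decide)).eventually (by decide)] with z hz
    exact hz.differentiableAt (by decide)
  have hd' := (continuousAt_extChartAt (I := 𝓡 m) x).eventually hd
  filter_upwards [hd', chart_source_eventually (m := m) x] with y hy hys
  have hφ : MDifferentiableAt (𝓡 m) 𝓘(ℝ, Model m) (extChartAt (𝓡 m) x) y :=
    mdifferentiableAt_extChartAt hys
  have he : f =ᶠ[𝓝 y] fun z => (f ∘ (extChartAt (𝓡 m) x).symm) (extChartAt (𝓡 m) x z) := by
    filter_upwards [(chartAt (Model m) x).open_source.mem_nhds hys] with z hz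
    have := (extChartAt (𝓡 m) x).left_inv (by simpa using hz)
    simp only [Function.comp_apply, this]
  rw [mvfderiv_congr he, mvfderiv_comp_of_hasFDerivAt (f := extChartAt (𝓡 m) x)
    (g := f ∘ (extChartAt (𝓡 m) x).symm) hy.hasFDerivAt hφ]
  congr 1
  exact mfderiv_extChartAt_extend v hys

theorem mvfderiv_mvfderiv_extend {f : M → ℝ} {x : M}
    (hf : ContMDiffAt (𝓡 m) 𝓘(ℝ, ℝ) ∞ f x) (u v : TangentSpace (𝓡 m) x) :
    MDifferentiableAt (𝓡 m) 𝓘(ℝ, ℝ)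
      (fun y => mvfderiv (𝓡 m) f y (FiberBundle.extend (Model m) v y)) x ∧
    mvfderiv (𝓡 m) (fun y => mvfderiv (𝓡 m) f y (FiberBundle.extend (Model m) v y)) x u =
      fderiv ℝ (fderiv ℝ (f ∘ (extChartAt (𝓡 m) x).symm)) (extChartAt (𝓡 m) x x)
        (u : Model m) (v : Model m) := by
  have hfc : ContDiffAt ℝ ∞ (f ∘ (extChartAt (𝓡 m) x).symm) (extChartAt (𝓡 m) x x) := by
    simpa [contMDiffAt_iff, contDiffWithinAt_univ] using! (contMDiffAt_iff.1 hf).2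
  have hd : DifferentiableAt ℝ (fderiv ℝ (f ∘ (extChartAt (𝓡 m) x).symm)) (extChartAt (𝓡 m) x x) :=
    ((hfc.of_le (m := 2) (by decide)).fderiv_right (m := 1) (by decide)).differentiableAt (by decide)
  have hφ : MDifferentiableAt (𝓡 m) 𝓘(ℝ, Model m) (extChartAt (𝓡 m) x) x :=
    mdifferentiableAt_extChartAt (mem_chart_source _ x)
  have hg := hd.hasFDerivAt.clm_apply (hasFDerivAt_const (v : Model m) (extChartAt (𝓡 m) x x))
  have he := mvfderiv_extend_eventuallyEq hf v
  refine ⟨(mdifferentiableAt_comp_of_hasFDerivAt hg hφ).congr_of_eventuallyEq he, ?_⟩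
  rw [mvfderiv_congr he, mvfderiv_comp_of_hasFDerivAt hg hφ]
  have h3 : mvfderiv (𝓡 m) (extChartAt (𝓡 m) x) x u = (u : Model m) := by
    have := mfderiv_extChartAt_extend u (mem_chart_source (Model m) x)
    rw [FiberBundle.extend_apply_self] at this
    exact this
  rw [h3]
  have h4 := map_zero (fderiv ℝ (f ∘ (extChartAt (𝓡 m) x).symm) (extChartAt (𝓡 m) x x))
  exact (congrArg (· + _) h4).trans (zero_add _)

/-- Second derivatives along coordinate vector fields commute. -/
theorem mvfderiv_mvfderiv_extend_comm {f : M → ℝ} {x : M}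
    (hf : ContMDiffAt (𝓡 m) 𝓘(ℝ, ℝ) ∞ f x) (u v : TangentSpace (𝓡 m) x) :
    mvfderiv (𝓡 m) (fun y => mvfderiv (𝓡 m) f y (FiberBundle.extend (Model m) v y)) x u =
    mvfderiv (𝓡 m) (fun y => mvfderiv (𝓡 m) f y (FiberBundle.extend (Model m) u y)) x v := by
  rw [(mvfderiv_mvfderiv_extend hf u v).2, (mvfderiv_mvfderiv_extend hf v u).2]
  have hfc : ContDiffAt ℝ ∞ (f ∘ (extChartAt (𝓡 m) x).symm) (extChartAt (𝓡 m) x x) := by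
    simpa [contMDiffAt_iff, contDiffWithinAt_univ] using! (contMDiffAt_iff.1 hf).2
  exact (hfc.isSymmSndFDerivAt (by simp; decide)) u v

theorem lieBracketWithin_const {E : Type*} [NormedAddCommGroup E] [NormedSpace ℝ E] (a b : E)
    (s : Set E) (z : E) :
    VectorField.lieBracketWithin ℝ (fun _ : E => a) (fun _ : E => b) s z = 0 := by
  simp [VectorField.lieBracketWithin_eq]

/-- Coordinate vector fields commute. -/
theorem mlieBracket_extend {x : M} (u v : TangentSpace (𝓡 m) x) :
    VectorField.mlieBracket (𝓡 m) (FiberBundle.extend (Model m) u)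
      (FiberBundle.extend (Model m) v) x = 0 := by
  have hconst : ∀ w : TangentSpace (𝓡 m) x,
      (VectorField.mpullbackWithin 𝓘(ℝ, Model m) (𝓡 m) (extChartAt (𝓡 m) x).symm
        (FiberBundle.extend (Model m) w) (Set.range (𝓡 m)) : Model m → Model m) =ᶠ[𝓝
          (extChartAt (𝓡 m) x x)] fun _ => (w : Model m) := by
    intro w
    filter_upwards [extChartAt_target_mem_nhds (I := 𝓡 m) x] with z hz
    have hz' : (extChartAt (𝓡 m) x).symm z ∈ (chartAt (Model m) x).source := by
      simpa using (extChartAt (𝓡 m) x).map_target hz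
    obtain ⟨e, he⟩ := isInvertible_mfderivWithin_extChartAt_symm (I := 𝓡 m) hz
    have h1 := mfderiv_extChartAt_extend w hz'
    have h2 := mfderiv_extChartAt_comp_mfderivWithin_extChartAt_symm (I := 𝓡 m) hz
    rw [VectorField.mpullbackWithin_apply, ← he, ContinuousLinearMap.inverse_equiv]
    rw [← he] at h2
    have h3 := congrArg (fun T => T (e.symm (FiberBundle.extend (Model m) w
      ((extChartAt (𝓡 m) x).symm z)))) h2
    simp only [ContinuousLinearMap.comp_apply, ContinuousLinearEquiv.coe_coe,
      ContinuousLinearEquiv.apply_symm_apply] at h3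
    exact h3.symm.trans h1
  rw [← VectorField.mlieBracketWithin_univ, VectorField.mlieBracketWithin_apply]
  have h := Filter.EventuallyEq.lieBracketWithin_vectorField_eq (𝕜 := ℝ)
    (s := (extChartAt (𝓡 m) x).symm ⁻¹' Set.univ ∩ Set.range (𝓡 m))
    ((hconst u).filter_mono nhdsWithin_le_nhds) (hconst u).self_of_nhds
    ((hconst v).filter_mono nhdsWithin_le_nhds) (hconst v).self_of_nhds
  rw [h]
  have h0 : VectorField.lieBracketWithin ℝ (fun _ : Model m => (u : Model m)) (fun _ => (v : Model m))
      ((extChartAt (𝓡 m) x).symm ⁻¹' Set.univ ∩ Set.range (𝓡 m)) (extChartAt (𝓡 m) x x) = 0 := by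
    exact lieBracketWithin_const (E := Model m) u v _ _
  rw [h0]
  exact map_zero _

end Coordinates

/-! ### Scalar products, traces and trace-free parts -/

section Algebra

variable {n : ℕ} {W A : Type*} [AddCommGroup W] [Module ℝ W] [AddCommGroup A] [Module ℝ A]

/-- A bilinear form is a scalar product if it is symmetric and positive definite. -/
structure IsScalarProduct (g : LinearMap.BilinForm ℝ W) : Prop where
  symm : ∀ X Y, g X Y = g Y X
  pos : ∀ X, X ≠ 0 → 0 < g X X

namespace IsScalarProduct

variable {g : LinearMap.BilinForm ℝ W} (hg : IsScalarProduct g)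
include hg

theorem eq_of_forall {X Y : W} (h : ∀ Z, g X Z = g Y Z) : X = Y := by
  by_contra hne
  have := hg.pos (X - Y) (sub_ne_zero.2 hne)
  have h2 := h (X - Y)
  simp only [map_sub, LinearMap.sub_apply] at this h2
  linarith

theorem nondegenerate : g.Nondegenerate := by
  refine ⟨fun X h => ?_, fun X h => ?_⟩
  · exact hg.eq_of_forall fun Z => by rw [h Z]; simp
  · exact hg.eq_of_forall fun Z => by rw [hg.symm, h Z]; simp

theorem isUnit_det_gram (w : Module.Basis (Fin n) ℝ W) :
    IsUnit (Matrix.det (Matrix.of fun a b => g (w a) (w b))) := by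
  have := (LinearMap.BilinForm.nondegenerate_iff_det_ne_zero w (B := g)).1 hg.nondegenerate
  rw [isUnit_iff_ne_zero]
  convert this using 2
  ext a b
  rw [LinearMap.BilinForm.toMatrix_apply, Matrix.of_apply]

theorem bilinTrace_self (w : Module.Basis (Fin n) ℝ W) :
    bilinTrace (fun X Y => g X Y) w (fun X Y => g X Y) = n := by
  set G := Matrix.of fun a b => g (w a) (w b)
  have h : G⁻¹ * G = 1 := Matrix.nonsing_inv_mul _ (hg.isUnit_det_gram w)
  have h2 : bilinTrace (fun X Y => g X Y) w (fun X Y => g X Y) = (G⁻¹ * G).trace := by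
    rw [Matrix.trace, bilinTrace]
    refine Finset.sum_congr rfl fun i _ => ?_
    rw [Matrix.diag_apply, Matrix.mul_apply]
    refine Finset.sum_congr rfl fun j _ => ?_
    rw [smul_eq_mul, hg.symm (w i)]
    rfl
  rw [h2, h]
  simp

/-- The trace-free part is unchanged when a multiple of the scalar product is added. -/
theorem traceFree_congr (w : Module.Basis (Fin n) ℝ W) (hn : n ≠ 0) {B B' : W → W → A} {a : A}
    (h : ∀ X Y, B' X Y = B X Y + g X Y • a) :
    traceFree (fun X Y => g X Y) w B' = traceFree (fun X Y => g X Y) w B := by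
  funext X Y
  have h1 : bilinTrace (fun X Y => g X Y) w B' =
      bilinTrace (fun X Y => g X Y) w B + (n : ℝ) • a := by
    rw [← hg.bilinTrace_self w]
    simp only [bilinTrace, h, Finset.sum_smul, ← Finset.sum_add_distrib, smul_add, smul_smul,
      smul_eq_mul]
  have hn' : (n : ℝ) ≠ 0 := Nat.cast_ne_zero.2 hn
  simp only [traceFree, h1, h X Y, smul_add, smul_smul]
  rw [show 1 / (n : ℝ) * g X Y * n = g X Y by field_simp]
  abel

/-- The projection of `V` to the span of a basis along the orthogonal complement. -/
theorem gram_inv_sum {V : Type*} [AddCommGroup V] [Module ℝ V] {g' : LinearMap.BilinForm ℝ V}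
    {j : W →ₗ[ℝ] V} (hj : ∀ X Y, g X Y = g' (j X) (j Y))
    (w : Module.Basis (Fin n) ℝ W) (U : V) (Z : W) :
    g' (j (∑ a, ∑ b, ((Matrix.of fun a b => g (w a) (w b))⁻¹ a b * g' U (j (w b))) • w a)) (j Z) =
      g' U (j Z) := by
  set G := Matrix.of fun a b => g (w a) (w b)
  have h : G⁻¹ * G = 1 := Matrix.nonsing_inv_mul _ (hg.isUnit_det_gram w)
  have key : ∀ c, g' (j (∑ a, ∑ b, (G⁻¹ a b * g' U (j (w b))) • w a)) (j (w c)) =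
      g' U (j (w c)) := by
    intro c
    have hs : ∀ a b, G a b = G b a := fun a b => hg.symm _ _
    have h1 : g' (j (∑ a, ∑ b, (G⁻¹ a b * g' U (j (w b))) • w a)) (j (w c)) =
        ∑ b, g' U (j (w b)) * (∑ a, G⁻¹ a b * G a c) := by
      rw [← hj]
      simp only [map_sum, map_smul, LinearMap.sum_apply, LinearMap.smul_apply, smul_eq_mul,
        Finset.mul_sum]
      rw [Finset.sum_comm]
      refine Finset.sum_congr rfl fun b _ => Finset.sum_congr rfl fun a _ => ?_
      change _ * G a c = _
      ring
    have hGi : ∀ a b, G⁻¹ a b = G⁻¹ b a := fun a b => by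
      have : G.transpose = G := by ext a b; exact hs b a
      conv_rhs => rw [← this, ← Matrix.transpose_nonsing_inv]
      rfl
    have h2 : ∀ b, ∑ a, G⁻¹ a b * G a c = if b = c then 1 else 0 := by
      intro b
      rw [← Matrix.one_apply, ← h, Matrix.mul_apply]
      exact Finset.sum_congr rfl fun a _ => by rw [hGi]
    rw [h1]
    simp [h2]
  have hlin := w.ext (f₁ := (g' (j (∑ a, ∑ b, (G⁻¹ a b * g' U (j (w b))) • w a))).comp j)
    (f₂ := (g' U).comp j) fun c => key c
  exact congrArg (fun T => T Z) hlin

/-- The basis dual to `b` with respect to the scalar product. -/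
theorem exists_dual (b : Module.Basis (Fin n) ℝ W) :
    ∃ d : Fin n → W, (∀ i X, b.coord i X = g X (d i)) ∧
      (∀ Y, ∑ i, g Y (d i) • b i = Y) ∧ ∀ Y, ∑ i, g Y (b i) • d i = Y := by
  have := Module.Finite.of_basis b
  have h1 : ∀ i X, b.coord i X = g X ((g.dualBasis hg.nondegenerate b) i) := by
    intro i X
    refine congrArg (fun T : W →ₗ[ℝ] ℝ => T X) (b.ext (f₁ := b.coord i)
      (f₂ := LinearMap.flip g ((g.dualBasis hg.nondegenerate b) i)) fun j => ?_)
    rw [LinearMap.flip_apply, hg.symm, LinearMap.BilinForm.apply_dualBasis_left]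
    simp [Finsupp.single_apply]
  refine ⟨fun i => (g.dualBasis hg.nondegenerate b) i, h1, fun Y => ?_, ?_⟩
  · simp only [← h1]
    exact b.sum_repr Y
  · intro Y
    conv_rhs => rw [← (g.dualBasis hg.nondegenerate b).sum_repr Y]
    simp only [LinearMap.BilinForm.dualBasis_repr_apply]

end IsScalarProduct

/-- The Koszul trick: a symmetric `A`, the difference of two torsion-free connections, is determined
by the one-form `γ` up to which it preserves the scalar product. -/
theorem IsScalarProduct.koszul_identity {V : Type*} [AddCommGroup V] [Module ℝ V] {g : LinearMap.BilinForm ℝ V}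
    (hg : IsScalarProduct g) {A : V → V → V} {γ : V → ℝ} (hA : ∀ X Y, A X Y = A Y X)
    (h : ∀ X Y Z, g (A X Y) Z + g Y (A X Z) = 2 * γ X * g Y Z) (X Y Z : V) :
    g (A X Y) Z = γ X * g Y Z + γ Y * g X Z - γ Z * g X Y := by
  have h1 := h X Y Z
  have h2 := h Y X Z
  have h3 := h Z X Y
  rw [hg.symm Y (A X Z)] at h1
  rw [hA Y X, hg.symm X (A Y Z)] at h2
  rw [hA Z X, hA Z Y, hg.symm X (A Y Z)] at h3
  linarith

/-- The contraction by which the Ricci tensor changes under a change of the Weyl structure. Here `A`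
is the difference of the connections, `γ` its one-form, `β` stands for the covariant derivative of
`γ`, and `d` is the basis dual to `b`. -/
theorem IsScalarProduct.exists_contraction {V : Type*} [AddCommGroup V] [Module ℝ V]
    {m : ℕ} {g : LinearMap.BilinForm ℝ V} (hg : IsScalarProduct g) (b : Module.Basis (Fin m) ℝ V)
    (β : LinearMap.BilinForm ℝ V) (γ : V →ₗ[ℝ] ℝ) {A : V → V → V}
    (hA : ∀ X Y Z, g (A X Y) Z = γ X * g Y Z + γ Y * g X Z - γ Z * g X Y) :
    ∃ d : Fin m → V, (∀ i X, b.coord i X = g X (d i)) ∧ ∃ κ : ℝ, ∀ X Y,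
      ∑ i, ((β (b i) X * g Y (d i) + β (b i) Y * g X (d i) - β (b i) (d i) * g X Y)
        - (β X (b i) * g Y (d i) + β X Y * g (b i) (d i) - β X (d i) * g (b i) Y)
        + g (A (b i) (A X Y)) (d i) - g (A X (A (b i) Y)) (d i)) =
      β X Y + (β Y X + (-(m * β X Y) + (((m : ℝ) - 2) * (γ X * γ Y) + g X Y * κ))) := by
  obtain ⟨d, hd1, hd2, hd3⟩ := hg.exists_dual b
  refine ⟨d, hd1, - ∑ i, β (b i) (d i) + (2 - (m : ℝ)) * ∑ i, γ (d i) * γ (b i), fun X Y => ?_⟩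
  have c1 : ∀ (f : V →ₗ[ℝ] ℝ) (V : V), ∑ i, f (b i) * g V (d i) = f V := fun f V => by
    conv_rhs => rw [← hd2 V, map_sum]
    simp [mul_comm]
  have c2 : ∀ (f : V →ₗ[ℝ] ℝ) (V : V), ∑ i, f (d i) * g V (b i) = f V := fun f V => by
    conv_rhs => rw [← hd3 V, map_sum]
    simp [mul_comm]
  have c3 : ∑ i, g (b i) (d i) = m := by
    simp only [← hd1]
    simp
  have hγA : γ (A X Y) = 2 * (γ X * γ Y) - g X Y * ∑ i, γ (d i) * γ (b i) := by
    rw [← c2 γ (A X Y)]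
    simp only [hA, mul_sub, mul_add, Finset.sum_add_distrib, Finset.sum_sub_distrib]
    have e1 : ∑ i, γ (d i) * (γ X * g Y (b i)) = γ X * γ Y := by
      rw [← c2 γ Y, Finset.mul_sum]; exact Finset.sum_congr rfl fun i _ => by ring
    have e2 : ∑ i, γ (d i) * (γ Y * g X (b i)) = γ Y * γ X := by
      rw [← c2 γ X, Finset.mul_sum]; exact Finset.sum_congr rfl fun i _ => by ring
    have e3 : ∑ i, γ (d i) * (γ (b i) * g X Y) = g X Y * ∑ i, γ (d i) * γ (b i) := by
      rw [Finset.mul_sum]; exact Finset.sum_congr rfl fun i _ => by ring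
    rw [e1, e2, e3]; ring
  have t1 : ∑ i, β (b i) X * g Y (d i) = β Y X := c1 (β.flip X) Y
  have t2 : ∑ i, β (b i) Y * g X (d i) = β X Y := c1 (β.flip Y) X
  have t3 : ∑ i, β X (b i) * g Y (d i) = β X Y := c1 (β X) Y
  have t4 : ∑ i, β X (d i) * g (b i) Y = β X Y := by
    simp only [hg.symm (b _) Y]; exact c2 (β X) Y
  have t5 : ∑ i, g (A (b i) (A X Y)) (d i) = m * γ (A X Y) := by
    have e3 : ∑ i, γ (d i) * g (b i) (A X Y) = γ (A X Y) := by
      simp only [hg.symm (b _) (A X Y)]; exact c2 γ _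
    simp only [hA, Finset.sum_add_distrib, Finset.sum_sub_distrib]
    simp only [← hA]
    rw [c1 γ (A X Y), e3, ← Finset.mul_sum, c3]; ring
  have hYd : ∑ i, γ (d i) * g (b i) Y = γ Y := by
    simp only [hg.symm (b _) Y]; exact c2 γ Y
  have hXd : ∑ i, γ (d i) * g (b i) X = γ X := by
    simp only [hg.symm (b _) X]; exact c2 γ X
  have t6 : ∑ i, g (A X (A (b i) Y)) (d i) = γ X * (m * γ Y) + γ (A X Y)
      - (∑ i, γ (d i) * γ (b i)) * g X Y := by
    have e1 : ∑ i, g (A (b i) Y) (d i) = m * γ Y := by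
      simp only [hA, Finset.sum_add_distrib, Finset.sum_sub_distrib, ← Finset.mul_sum]
      rw [c1 γ Y, hYd, c3]; ring
    have e2 : ∑ i, γ (A (b i) Y) * g X (d i) = γ (A X Y) := by
      have hAl : ∀ (X X' : V) (a : ℝ), A (X + a • X') Y = A X Y + a • A X' Y := fun (X X' : V) (a : ℝ) =>
        hg.eq_of_forall fun Z => by
          simp only [hA, map_add, map_smul, LinearMap.add_apply, LinearMap.smul_apply, smul_eq_mul]
          ring
      have h0 : A 0 Y = 0 := by
        have := hAl 0 0 1
        simpa using this
      have hsum : ∀ (s : Finset (Fin m)), A (∑ i ∈ s, g X (d i) • b i) Y =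
          ∑ i ∈ s, g X (d i) • A (b i) Y := by
        intro s
        induction s using Finset.cons_induction with
        | empty => simpa using h0
        | cons a s ha ih => rw [Finset.sum_cons, Finset.sum_cons, add_comm, hAl, ih, add_comm]
      conv_rhs => rw [← hd2 X, hsum, map_sum]
      simp [mul_comm]
    have e3 : ∑ i, γ (d i) * g X (A (b i) Y) = (∑ i, γ (d i) * γ (b i)) * g X Y := by
      have : ∀ i, γ (d i) * g X (A (b i) Y) = γ (d i) * γ (b i) * g X Y
          + γ Y * (γ (d i) * g (b i) X) - γ X * (γ (d i) * g (b i) Y) := fun i => by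
        rw [hg.symm X, hA, hg.symm Y X]; ring
      simp only [this, Finset.sum_add_distrib, Finset.sum_sub_distrib, ← Finset.mul_sum]
      rw [hYd, hXd, ← Finset.sum_mul]; ring
    simp only [hA X, Finset.sum_add_distrib, Finset.sum_sub_distrib, ← Finset.mul_sum]
    rw [e1, e2, e3]
  have t7 : ∑ i, β (b i) (d i) * g X Y = g X Y * ∑ i, β (b i) (d i) := by
    rw [Finset.mul_sum]; exact Finset.sum_congr rfl fun i _ => by ring
  simp only [Finset.sum_add_distrib, Finset.sum_sub_distrib]
  rw [t1, t2, t3, t4, t5, t6, t7, ← Finset.mul_sum, c3, hγA]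
  ring

omit [AddCommGroup W] [Module ℝ W] in
theorem bilinTrace_map {A' : Type*} [AddCommGroup A'] [Module ℝ A'] (g : W → W → ℝ)
    (w : Fin n → W) (B : W → W → A) (T : A →ₗ[ℝ] A') :
    bilinTrace g w (fun X Y => T (B X Y)) = T (bilinTrace g w B) := by
  simp [bilinTrace, map_sum]

omit [AddCommGroup W] [Module ℝ W] in
theorem traceFree_map {A' : Type*} [AddCommGroup A'] [Module ℝ A'] (g : W → W → ℝ) (w : Fin n → W)
    (B : W → W → A) (T : A →ₗ[ℝ] A') (X Y : W) :
    traceFree g w (fun X Y => T (B X Y)) X Y = T (traceFree g w B X Y) := by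
  simp [traceFree, bilinTrace, map_sum]

omit [AddCommGroup W] [Module ℝ W] in
theorem traceFree_add (g : W → W → ℝ) (w : Fin n → W) (B B' : W → W → A) (X Y : W) :
    traceFree g w (fun X Y => B X Y + B' X Y) X Y = traceFree g w B X Y + traceFree g w B' X Y := by
  simp only [traceFree, bilinTrace, smul_add, Finset.sum_add_distrib]
  abel

end Algebra

/-! ### Differences of Weyl structures -/

section Weyl

variable {m : ℕ} {M : Type*} [TopologicalSpace M] [ChartedSpace (Model m) M]
  [IsManifold (𝓡 m) ∞ M]

/-- The scalar product `c.rep x` as a bilinear form. -/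
noncomputable def ConformalStructure.repForm (c : ConformalStructure m M) (x : M) :
    LinearMap.BilinForm ℝ (TangentSpace (𝓡 m) x) :=
  LinearMap.mk₂ ℝ (c.rep x) (fun X X' Y => by simp [ConformalStructure.rep])
    (fun a X Y => by simp [ConformalStructure.rep]) (fun X Y Y' => by simp [ConformalStructure.rep])
    (fun a X Y => by simp [ConformalStructure.rep])

theorem ConformalStructure.repForm_apply (c : ConformalStructure m M) (x : M)
    (X Y : TangentSpace (𝓡 m) x) : c.repForm x X Y = c.rep x X Y := rfl

theorem ConformalStructure.isScalarProduct (c : ConformalStructure m M) (x : M) :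
    IsScalarProduct (c.repForm x) where
  symm X Y := by simp only [repForm_apply, rep, c.symm x X Y]
  pos X hX := c.pos x X hX _ (coordBasis x).linearIndependent

/-- The values of `c` on the coordinate frame at `x`: a metric in the conformal class, defined in
the chart domain around `x`. -/
noncomputable def ConformalStructure.localRep (c : ConformalStructure m M) (x y : M)
    (X Y : TangentSpace (𝓡 m) y) : ℝ :=
  (c.form y X Y).1 (fun i => coordFrame x i y)

theorem ConformalStructure.localRep_self (c : ConformalStructure m M) (x : M)
    (X Y : TangentSpace (𝓡 m) x) : c.localRep x x X Y = c.rep x X Y := by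
  rw [localRep, rep, coe_coordBasis]

theorem ConformalStructure.mdifferentiableAt_localRep (c : ConformalStructure m M) {x : M}
    {V W : ∀ y : M, TangentSpace (𝓡 m) y}
    (hV : MDifferentiableAt (𝓡 m) (𝓡 m).tangent (fun y => (⟨y, V y⟩ : TangentBundle (𝓡 m) M)) x)
    (hW : MDifferentiableAt (𝓡 m) (𝓡 m).tangent (fun y => (⟨y, W y⟩ : TangentBundle (𝓡 m) M)) x) :
    MDifferentiableAt (𝓡 m) 𝓘(ℝ, ℝ) (fun y => c.localRep x y (V y) (W y)) x := by
  have hx := mem_chart_source (Model m) x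
  have h : (fun y => c.localRep x y (V y) (W y)) =ᶠ[𝓝 x] fun y => ∑ i, ∑ j,
      (frameCoord x i V y * frameCoord x j W y) *
        (c.form y (coordFrame x i y) (coordFrame x j y)).1 (fun i => coordFrame x i y) := by
    filter_upwards [chart_source_eventually (m := m) x] with y hy
    rw [localRep]
    conv_lhs => rw [eq_sum_frameCoord hy V, eq_sum_frameCoord hy W]
    simp only [map_sum, map_smul, LinearMap.sum_apply, LinearMap.smul_apply, Submodule.coe_sum,
      Submodule.coe_smul, Finset.sum_apply, Pi.smul_apply, smul_eq_mul, Finset.mul_sum]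
    rw [Finset.sum_comm]
    refine Finset.sum_congr rfl fun i _ => Finset.sum_congr rfl fun j _ => ?_
    ring
  refine MDifferentiableAt.congr_of_eventuallyEq ?_ h
  refine (mvfderiv_sum _ (fun i _ => (mvfderiv_sum _ (fun j _ => ?_) 0).2) 0).2
  exact ((mdifferentiableAt_frameCoord hx hV i).mul (mdifferentiableAt_frameCoord hx hW j)).mul
    ((c.smooth x i j).mdifferentiableAt (by simp))

variable {c : ConformalStructure m M}

namespace WeylStructure

/-- The connection form on `L` in the coordinate frame at the point. -/
noncomputable def lineForm (D : WeylStructure c) (x : M) : TangentSpace (𝓡 m) x →ₗ[ℝ] ℝ :=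
  (1 / (m : ℝ)) • ∑ i, (coordBasis x).coord i ∘ₗ (D.conn (coordFrame x i) x).toLinearMap

theorem lineForm_apply (D : WeylStructure c) (x : M) (X : TangentSpace (𝓡 m) x) :
    D.lineForm x X = 1 / (m : ℝ) * connTrace D.conn x X := by
  simp [lineForm, connTrace]

theorem covWeight_apply (D : WeylStructure c) (k : ℝ)
    (l : ∀ x : M, weightSpace m k (TangentSpace (𝓡 m) x)) (x : M) (X : TangentSpace (𝓡 m) x) :
    (covWeight k D.conn l x X).1 (coordBasis x) =
      mvfderiv (𝓡 m) (fun y => (l y).1 (fun i => coordFrame x i y)) x X +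
        k * D.lineForm x X * (l x).1 (coordBasis x) := by
  rw [covWeight, weightOfBasis_apply, lineForm_apply]
  ring

/-- A Weyl connection preserves `c`, in terms of the metric given by the chart at `x`. -/
theorem mvfderiv_localRep (D : WeylStructure c) {x : M} (X : TangentSpace (𝓡 m) x)
    {Y Z : ∀ y : M, TangentSpace (𝓡 m) y}
    (hY : MDifferentiableAt (𝓡 m) (𝓡 m).tangent (fun y => (⟨y, Y y⟩ : TangentBundle (𝓡 m) M)) x)
    (hZ : MDifferentiableAt (𝓡 m) (𝓡 m).tangent (fun y => (⟨y, Z y⟩ : TangentBundle (𝓡 m) M)) x) :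
    mvfderiv (𝓡 m) (fun y => c.localRep x y (Y y) (Z y)) x X =
      c.repForm x (D.conn Y x X) (Z x) + c.repForm x (Y x) (D.conn Z x X)
        - 2 * D.lineForm x X * c.repForm x (Y x) (Z x) := by
  have h := congrArg (fun φ => φ.1 (coordBasis x)) (D.conformal x X Y Z hY hZ)
  simp only [D.covWeight_apply] at h
  simp only [ConformalStructure.repForm_apply, ConformalStructure.rep]
  change _ = (c.form x (D.conn Y x X) (Z x)).1 (coordBasis x) +
    (c.form x (Y x) (D.conn Z x X)).1 (coordBasis x) at h
  rw [← h]
  simp only [ConformalStructure.localRep]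
  ring

/-- The difference `D' - D` of two Weyl structures: `∇'_X Y - ∇_X Y` is `diff D D' x Y X`. -/
noncomputable def diff (D D' : WeylStructure c) (x : M) :
    TangentSpace (𝓡 m) x →L[ℝ] TangentSpace (𝓡 m) x →L[ℝ] TangentSpace (𝓡 m) x :=
  D'.conn.difference D.conn x

/-- The one-form by which two Weyl structures differ. -/
noncomputable def diffForm (D D' : WeylStructure c) (x : M) : TangentSpace (𝓡 m) x →ₗ[ℝ] ℝ :=
  D'.lineForm x - D.lineForm x

theorem diff_apply (D D' : WeylStructure c) {x : M} {Y : ∀ y : M, TangentSpace (𝓡 m) y}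
    (hY : MDifferentiableAt (𝓡 m) (𝓡 m).tangent (fun y => (⟨y, Y y⟩ : TangentBundle (𝓡 m) M)) x)
    (X : TangentSpace (𝓡 m) x) :
    D'.conn Y x X = D.conn Y x X + D.diff D' x (Y x) X := by
  have h := IsCovariantDerivativeOn.difference_apply D'.conn.isCovariantDerivativeOnUniv
    D.conn.isCovariantDerivativeOnUniv (x := x) (Set.mem_univ x) hY
  rw [diff, CovariantDerivative.difference, h]
  simp

theorem covWeight_diff (D D' : WeylStructure c) (k : ℝ)
    (l : ∀ x : M, weightSpace m k (TangentSpace (𝓡 m) x)) (x : M) (X : TangentSpace (𝓡 m) x) :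
    covWeight k D'.conn l x X = covWeight k D.conn l x X + (k * D.diffForm D' x X) • l x := by
  refine weightSpace_ext (coordBasis x) ?_
  rw [covWeight_apply]
  change _ = (covWeight k D.conn l x X).1 (coordBasis x) +
    (k * D.diffForm D' x X) * (l x).1 (coordBasis x)
  rw [covWeight_apply, diffForm, LinearMap.sub_apply]
  ring

theorem torsion_apply (D : WeylStructure c) {x : M} {X Y : ∀ y : M, TangentSpace (𝓡 m) y}
    (hX : MDifferentiableAt (𝓡 m) (𝓡 m).tangent (fun y => (⟨y, X y⟩ : TangentBundle (𝓡 m) M)) x)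
    (hY : MDifferentiableAt (𝓡 m) (𝓡 m).tangent (fun y => (⟨y, Y y⟩ : TangentBundle (𝓡 m) M)) x) :
    D.conn Y x (X x) - D.conn X x (Y x) = VectorField.mlieBracket (𝓡 m) X Y x :=
  (CovariantDerivative.torsion_eq_zero_iff D.conn).1 D.torsion_free hX hY

theorem cov_extend_comm (D : WeylStructure c) {x : M} (X Y : TangentSpace (𝓡 m) x) :
    D.conn (FiberBundle.extend (Model m) Y) x X = D.conn (FiberBundle.extend (Model m) X) x Y := by
  have hx := mem_chart_source (Model m) x
  have h := D.torsion_apply (mdifferentiableAt_extend_of_mem X hx)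
    (mdifferentiableAt_extend_of_mem Y hx)
  rw [mlieBracket_extend, FiberBundle.extend_apply_self, FiberBundle.extend_apply_self] at h
  exact sub_eq_zero.1 h

theorem diff_symm (D D' : WeylStructure c) (x : M) (X Y : TangentSpace (𝓡 m) x) :
    D.diff D' x X Y = D.diff D' x Y X := by
  have hx := mem_chart_source (Model m) x
  have h1 := D.diff_apply D' (mdifferentiableAt_extend_of_mem X hx) Y
  have h2 := D.diff_apply D' (mdifferentiableAt_extend_of_mem Y hx) X
  rw [D.cov_extend_comm Y X, D'.cov_extend_comm Y X, FiberBundle.extend_apply_self] at h1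
  rw [FiberBundle.extend_apply_self, h1] at h2
  exact add_left_cancel h2

/-- The difference of two Weyl structures is `A(X, Y) = γ(X) Y + γ(Y) X - c(X, Y) γ^♯`. -/
theorem repForm_diff (D D' : WeylStructure c) (x : M) (X Y Z : TangentSpace (𝓡 m) x) :
    c.repForm x (D.diff D' x X Y) Z = D.diffForm D' x X * c.repForm x Y Z +
      D.diffForm D' x Y * c.repForm x X Z - D.diffForm D' x Z * c.repForm x X Y := by
  have hx := mem_chart_source (Model m) x
  refine IsScalarProduct.koszul_identity (c.isScalarProduct x) (A := fun X Y => D.diff D' x X Y)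
    (D.diff_symm D' x) (fun X Y Z => ?_) X Y Z
  have hY := mdifferentiableAt_extend_of_mem Y hx
  have hZ := mdifferentiableAt_extend_of_mem Z hx
  have h1 := D.mvfderiv_localRep X hY hZ
  have h2 := D'.mvfderiv_localRep X hY hZ
  rw [D.diff_apply D' hY, D.diff_apply D' hZ, h1] at h2
  simp only [FiberBundle.extend_apply_self, map_add, LinearMap.add_apply] at h2
  rw [D.diff_symm D' x X Y, D.diff_symm D' x X Z, diffForm, LinearMap.sub_apply]
  linarith

theorem form_diff (D D' : WeylStructure c) (x : M) (X Y Z : TangentSpace (𝓡 m) x) :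
    c.form x (D.diff D' x X Y) Z = D.diffForm D' x X • c.form x Y Z +
      D.diffForm D' x Y • c.form x X Z - D.diffForm D' x Z • c.form x X Y :=
  weightSpace_ext (coordBasis x) (D.repForm_diff D' x X Y Z)

theorem localRep_diff (D D' : WeylStructure c) (x y : M) (X Y Z : TangentSpace (𝓡 m) y) :
    c.localRep x y (D.diff D' y X Y) Z = D.diffForm D' y X * c.localRep x y Y Z +
      D.diffForm D' y Y * c.localRep x y X Z - D.diffForm D' y Z * c.localRep x y X Y :=
  congrArg (fun φ => φ.1 (fun i => coordFrame x i y)) (D.form_diff D' y X Y Z)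

end WeylStructure
end Weyl

/-! ### Change of the curvature -/

section Change

variable {m : ℕ} {M : Type*} [TopologicalSpace M] [ChartedSpace (Model m) M]
  [IsManifold (𝓡 m) ∞ M]

theorem cov_extend_add (D : CovariantDerivative (𝓡 m) (Model m) (TangentSpace (𝓡 m) : M → Type _))
    {x : M} (v w : TangentSpace (𝓡 m) x) :
    D (FiberBundle.extend (Model m) (v + w)) x =
      D (FiberBundle.extend (Model m) v) x + D (FiberBundle.extend (Model m) w) x := by
  have hx := mem_chart_source (Model m) x
  have hv := mdifferentiableAt_extend_of_mem v hx
  have hw := mdifferentiableAt_extend_of_mem w hx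
  rw [← D.isCovariantDerivativeOnUniv.add hv hw]
  refine D.isCovariantDerivativeOnUniv.congr_of_eventuallyEq (mdifferentiableAt_extend_of_mem _ hx)
    (mdifferentiableAt_add_section hv hw) Filter.univ_mem ?_
  filter_upwards [chart_source_eventually (m := m) x] with y hy
  rw [Pi.add_apply, ← extendₗ_apply x y hy, map_add, extendₗ_apply, extendₗ_apply]

theorem cov_extend_smul (D : CovariantDerivative (𝓡 m) (Model m) (TangentSpace (𝓡 m) : M → Type _))
    {x : M} (a : ℝ) (v : TangentSpace (𝓡 m) x) :
    D (FiberBundle.extend (Model m) (a • v)) x = a • D (FiberBundle.extend (Model m) v) x := by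
  have hx := mem_chart_source (Model m) x
  have hv := mdifferentiableAt_extend_of_mem v hx
  rw [← D.isCovariantDerivativeOnUniv.smul_const a hv]
  refine D.isCovariantDerivativeOnUniv.congr_of_eventuallyEq (mdifferentiableAt_extend_of_mem _ hx)
    (hv.smul_const_section (a := a)) Filter.univ_mem ?_
  filter_upwards [chart_source_eventually (m := m) x] with y hy
  rw [Pi.smul_apply, ← extendₗ_apply x y hy, map_smul, extendₗ_apply]

theorem curvature_eq (D : Conn m M) (x : M) (X Y Z : TangentSpace (𝓡 m) x)
    (h0 : D (FiberBundle.extend (Model m) Z) x 0 = 0 := map_zero _) :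
    curvature D x X Y Z =
      D (fun y => D (FiberBundle.extend (Model m) Z) y (FiberBundle.extend (Model m) Y y)) x X -
      D (fun y => D (FiberBundle.extend (Model m) Z) y (FiberBundle.extend (Model m) X y)) x Y := by
  simp only [curvature, mlieBracket_extend, h0, sub_zero]

theorem curvature_antisymm (D : Conn m M) (x : M) (X Y Z : TangentSpace (𝓡 m) x) :
    curvature D x X Y Z = - curvature D x Y X Z := by
  rw [curvature_eq, curvature_eq, neg_sub]

variable {c : ConformalStructure m M}

namespace WeylStructure

variable [T2Space M] (D D' : WeylStructure c)

omit [T2Space M] in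
theorem diff_extend_eventuallyEq {x : M} (Y Z : TangentSpace (𝓡 m) x) :
    ∀ᶠ y in 𝓝 x, D'.conn (FiberBundle.extend (Model m) Z) y (FiberBundle.extend (Model m) Y y) =
      D.conn (FiberBundle.extend (Model m) Z) y (FiberBundle.extend (Model m) Y y) +
        D.diff D' y (FiberBundle.extend (Model m) Z y) (FiberBundle.extend (Model m) Y y) := by
  filter_upwards [chart_source_eventually (m := m) x] with y hy
  exact D.diff_apply D' (mdifferentiableAt_extend_of_mem Z hy) _

theorem mdifferentiableAt_diff_extend {x : M} (Y Z : TangentSpace (𝓡 m) x) :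
    MDifferentiableAt (𝓡 m) (𝓡 m).tangent (fun y => (⟨y, D.diff D' y
      (FiberBundle.extend (Model m) Z y) (FiberBundle.extend (Model m) Y y)⟩ :
        TangentBundle (𝓡 m) M)) x := by
  refine MDifferentiableAt.congr_of_eventuallyEq (mdifferentiableAt_sub_section
    (mdifferentiableAt_cov_extend D'.conn D'.smooth Z Y)
    (mdifferentiableAt_cov_extend D.conn D.smooth Z Y)) ?_
  filter_upwards [D.diff_extend_eventuallyEq D' Y Z] with y hy
  simp only [Pi.sub_apply]
  rw [hy, add_sub_cancel_left]

/-- The one-form by which two Weyl structures differ is differentiable. It is recovered from their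
difference tensor `A` as the quotient `γ(Y) = c(A(Y, Y), Y) / c(Y, Y)`. -/
theorem mdifferentiableAt_diffForm_extend {x : M} (Y : TangentSpace (𝓡 m) x) :
    MDifferentiableAt (𝓡 m) 𝓘(ℝ, ℝ)
      (fun y => D.diffForm D' y (FiberBundle.extend (Model m) Y y)) x := by
  have hx := mem_chart_source (Model m) x
  by_cases hY : Y = 0
  · refine MDifferentiableAt.congr_of_eventuallyEq (mdifferentiableAt_const (c := (0 : ℝ))) ?_
    filter_upwards [chart_source_eventually (m := m) x] with y hy
    rw [hY, ← extendₗ_apply x y hy, map_zero, map_zero]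
  have hE := mdifferentiableAt_extend_of_mem Y hx
  have h1 := c.mdifferentiableAt_localRep (D.mdifferentiableAt_diff_extend D' Y Y) hE
  have h2 := c.mdifferentiableAt_localRep hE hE
  have hpos : c.localRep x x (FiberBundle.extend (Model m) Y x)
      (FiberBundle.extend (Model m) Y x) ≠ 0 := by
    rw [FiberBundle.extend_apply_self, c.localRep_self]
    exact ((c.isScalarProduct x).pos Y hY).ne'
  have h3 := mdifferentiableAt_comp_of_hasFDerivAt (f := fun y => c.localRep x y
    (FiberBundle.extend (Model m) Y y) (FiberBundle.extend (Model m) Y y)) (g := fun t : ℝ => t⁻¹)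
    (hasDerivAt_inv hpos).hasFDerivAt h2
  refine MDifferentiableAt.congr_of_eventuallyEq (h1.mul h3) ?_
  filter_upwards [h2.continuousAt.eventually_ne hpos] with y hy
  rw [Pi.mul_apply, D.localRep_diff D']
  field_simp
  ring

/-- The covariant derivative `(∇_X γ)(Y)` of the one-form `γ` by which two Weyl structures
differ. -/
noncomputable def covDiffForm (x : M) : LinearMap.BilinForm ℝ (TangentSpace (𝓡 m) x) :=
  LinearMap.mk₂ ℝ (fun X Y =>
    mvfderiv (𝓡 m) (fun y => D.diffForm D' y (FiberBundle.extend (Model m) Y y)) x X -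
      D.diffForm D' x (D.conn (FiberBundle.extend (Model m) Y) x X))
    (fun X X' Y => by simp only [map_add]; ring)
    (fun a X Y => by simp only [map_smul, smul_eq_mul]; ring)
    (fun X Y Y' => by
      have h : (fun y => D.diffForm D' y (FiberBundle.extend (Model m) (Y + Y') y)) =ᶠ[𝓝 x]
          fun y => D.diffForm D' y (FiberBundle.extend (Model m) Y y) +
            D.diffForm D' y (FiberBundle.extend (Model m) Y' y) := by
        filter_upwards [chart_source_eventually (m := m) x] with y hy
        rw [← extendₗ_apply x y hy, map_add, map_add, extendₗ_apply, extendₗ_apply]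
      rw [mvfderiv_congr h, mvfderiv_fun_add (D.mdifferentiableAt_diffForm_extend D' Y)
        (D.mdifferentiableAt_diffForm_extend D' Y'), cov_extend_add]
      simp only [add_apply, map_add]
      ring)
    (fun a X Y => by
      have h : (fun y => D.diffForm D' y (FiberBundle.extend (Model m) (a • Y) y)) =ᶠ[𝓝 x]
          fun y => (fun _ => a) y * D.diffForm D' y (FiberBundle.extend (Model m) Y y) := by
        filter_upwards [chart_source_eventually (m := m) x] with y hy
        rw [← extendₗ_apply x y hy, map_smul, map_smul, extendₗ_apply, smul_eq_mul]
      rw [mvfderiv_congr h, mvfderiv_fun_mul mdifferentiableAt_const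
        (D.mdifferentiableAt_diffForm_extend D' Y), cov_extend_smul, mvfderiv_const]
      simp only [smul_zero, add_zero, smul_apply, map_smul, smul_eq_mul]
      ring)

theorem covDiffForm_apply (x : M) (X Y : TangentSpace (𝓡 m) x) :
    D.covDiffForm D' x X Y =
      mvfderiv (𝓡 m) (fun y => D.diffForm D' y (FiberBundle.extend (Model m) Y y)) x X -
        D.diffForm D' x (D.conn (FiberBundle.extend (Model m) Y) x X) := rfl

/-- The covariant derivative of the difference `A` of two Weyl structures, obtained by
differentiating `c(A(Y, Z), W) = γ(Y) c(Z, W) + γ(Z) c(Y, W) - γ(W) c(Y, Z)`. -/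
theorem repForm_cov_diff (x : M) (X Y Z W : TangentSpace (𝓡 m) x) :
    c.repForm x (D.conn (fun y => D.diff D' y (FiberBundle.extend (Model m) Z y)
      (FiberBundle.extend (Model m) Y y)) x X) W =
    D.covDiffForm D' x X Y * c.repForm x Z W + D.covDiffForm D' x X Z * c.repForm x Y W
      - D.covDiffForm D' x X W * c.repForm x Y Z
      + c.repForm x (D.diff D' x (D.conn (FiberBundle.extend (Model m) Y) x X) Z) W
      + c.repForm x (D.diff D' x Y (D.conn (FiberBundle.extend (Model m) Z) x X)) W := by
  have hx := mem_chart_source (Model m) x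
  have hY := mdifferentiableAt_extend_of_mem Y hx
  have hZ := mdifferentiableAt_extend_of_mem Z hx
  have hW := mdifferentiableAt_extend_of_mem W hx
  have h1 := D.mvfderiv_localRep X (D.mdifferentiableAt_diff_extend D' Y Z) hW
  simp only [D.localRep_diff D'] at h1
  have dY := D.mdifferentiableAt_diffForm_extend D' Y
  have dZ := D.mdifferentiableAt_diffForm_extend D' Z
  have dW := D.mdifferentiableAt_diffForm_extend D' W
  have gYW := c.mdifferentiableAt_localRep hY hW
  have gZW := c.mdifferentiableAt_localRep hZ hW
  have gZY := c.mdifferentiableAt_localRep hZ hY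
  have p1 : MDifferentiableAt (𝓡 m) 𝓘(ℝ, ℝ) (fun y => D.diffForm D' y (FiberBundle.extend (Model m) Z y)
    * c.localRep x y (FiberBundle.extend (Model m) Y y) (FiberBundle.extend (Model m) W y)) x :=
    dZ.mul gYW
  have p2 : MDifferentiableAt (𝓡 m) 𝓘(ℝ, ℝ) (fun y => D.diffForm D' y (FiberBundle.extend (Model m) Y y)
    * c.localRep x y (FiberBundle.extend (Model m) Z y) (FiberBundle.extend (Model m) W y)) x :=
    dY.mul gZW
  have p3 : MDifferentiableAt (𝓡 m) 𝓘(ℝ, ℝ) (fun y => D.diffForm D' y (FiberBundle.extend (Model m) W y)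
    * c.localRep x y (FiberBundle.extend (Model m) Z y) (FiberBundle.extend (Model m) Y y)) x :=
    dW.mul gZY
  have p4 : MDifferentiableAt (𝓡 m) 𝓘(ℝ, ℝ) (fun y => D.diffForm D' y (FiberBundle.extend (Model m) Z y)
    * c.localRep x y (FiberBundle.extend (Model m) Y y) (FiberBundle.extend (Model m) W y) +
    D.diffForm D' y (FiberBundle.extend (Model m) Y y)
    * c.localRep x y (FiberBundle.extend (Model m) Z y) (FiberBundle.extend (Model m) W y)) x :=
    p1.add p2
  rw [mvfderiv_fun_sub p4 p3, mvfderiv_fun_add p1 p2, mvfderiv_fun_mul dZ gYW, mvfderiv_fun_mul dY gZW,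
    mvfderiv_fun_mul dW gZY] at h1
  simp only [add_apply, sub_apply, smul_apply, D.mvfderiv_localRep X hY hW,
    D.mvfderiv_localRep X hZ hW, D.mvfderiv_localRep X hZ hY, FiberBundle.extend_apply_self,
    smul_eq_mul, c.localRep_self, ← c.repForm_apply, D.repForm_diff D'] at h1
  simp only [covDiffForm_apply, D.repForm_diff D']
  have s1 := (c.isScalarProduct x).symm
  rw [s1 Z Y, s1 Z (D.conn (FiberBundle.extend (Model m) Y) x X)] at h1
  rw [s1 Y (D.conn (FiberBundle.extend (Model m) Z) x X)]
  linarith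

theorem curvature_diff (x : M) (X Y Z : TangentSpace (𝓡 m) x) :
    curvature D'.conn x X Y Z = curvature D.conn x X Y Z
      + (D.conn (fun y => D.diff D' y (FiberBundle.extend (Model m) Z y)
          (FiberBundle.extend (Model m) Y y)) x X
        + D.diff D' x (D.conn (FiberBundle.extend (Model m) Z) x Y) X
        + D.diff D' x (D.diff D' x Z Y) X)
      - (D.conn (fun y => D.diff D' y (FiberBundle.extend (Model m) Z y)
          (FiberBundle.extend (Model m) X y)) x Y
        + D.diff D' x (D.conn (FiberBundle.extend (Model m) Z) x X) Y
        + D.diff D' x (D.diff D' x Z X) Y) := by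
  have key : ∀ X Y : TangentSpace (𝓡 m) x, D'.conn (fun y => D'.conn (FiberBundle.extend (Model m) Z)
      y (FiberBundle.extend (Model m) Y y)) x X =
      D.conn (fun y => D.conn (FiberBundle.extend (Model m) Z) y
        (FiberBundle.extend (Model m) Y y)) x X +
      (D.conn (fun y => D.diff D' y (FiberBundle.extend (Model m) Z y)
          (FiberBundle.extend (Model m) Y y)) x X
        + D.diff D' x (D.conn (FiberBundle.extend (Model m) Z) x Y) X
        + D.diff D' x (D.diff D' x Z Y) X) := by
    intro X Y
    have d1 := mdifferentiableAt_cov_extend D.conn D.smooth Z Y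
    have d2 := D.mdifferentiableAt_diff_extend D' Y Z
    have d3 := mdifferentiableAt_cov_extend D'.conn D'.smooth Z Y
    rw [D.diff_apply D' d3]
    have h1 := D.conn.isCovariantDerivativeOnUniv.congr_of_eventuallyEq d3
      (mdifferentiableAt_add_section d1 d2) Filter.univ_mem (D.diff_extend_eventuallyEq D' Y Z)
    have h2 := D.conn.isCovariantDerivativeOnUniv.add d1 d2
    have h3 : D.conn (fun y => D'.conn (FiberBundle.extend (Model m) Z)
      y (FiberBundle.extend (Model m) Y y)) x = _ := h1.trans h2
    rw [h3, (D.diff_extend_eventuallyEq D' Y Z).self_of_nhds]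
    simp only [FiberBundle.extend_apply_self, map_add, add_apply]
    abel
  rw [curvature_eq, curvature_eq, key, key]
  abel

theorem repForm_curvature_diff (x : M) (X Y Z W : TangentSpace (𝓡 m) x) :
    c.repForm x (curvature D'.conn x X Y Z) W = c.repForm x (curvature D.conn x X Y Z) W
      + (D.covDiffForm D' x X Y * c.repForm x Z W + D.covDiffForm D' x X Z * c.repForm x Y W
        - D.covDiffForm D' x X W * c.repForm x Y Z)
      - (D.covDiffForm D' x Y X * c.repForm x Z W + D.covDiffForm D' x Y Z * c.repForm x X W
        - D.covDiffForm D' x Y W * c.repForm x X Z)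
      + c.repForm x (D.diff D' x X (D.diff D' x Y Z)) W
      - c.repForm x (D.diff D' x Y (D.diff D' x X Z)) W := by
  rw [D.curvature_diff D']
  simp only [map_add, map_sub, LinearMap.add_apply, LinearMap.sub_apply, D.repForm_cov_diff D']
  rw [D.cov_extend_comm Y X, D.diff_symm D' x (D.conn (FiberBundle.extend (Model m) Z) x Y) X,
    D.diff_symm D' x (D.conn (FiberBundle.extend (Model m) Z) x X) Y,
    D.diff_symm D' x (D.diff D' x Z Y) X, D.diff_symm D' x (D.diff D' x Z X) Y,
    D.diff_symm D' x Z Y, D.diff_symm D' x Z X]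
  ring

/-- The change of the Ricci tensor, up to multiples of the metric. -/
theorem exists_ricci_diff (x : M) : ∃ κ : ℝ, ∀ X Y : TangentSpace (𝓡 m) x,
    ricci D'.conn x X Y = ricci D.conn x X Y + D.covDiffForm D' x X Y + D.covDiffForm D' x Y X
      - m * D.covDiffForm D' x X Y
      + ((m : ℝ) - 2) * (D.diffForm D' x X * D.diffForm D' x Y) + c.repForm x X Y * κ := by
  obtain ⟨d, hd, κ, hκ⟩ := (c.isScalarProduct x).exists_contraction (coordBasis x)
    (D.covDiffForm D' x) (D.diffForm D' x) (A := fun X Y => D.diff D' x X Y) (D.repForm_diff D' x)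
  refine ⟨κ, fun X Y => ?_⟩
  have hric : ∀ D : WeylStructure c, ricci D.conn x X Y =
      ∑ i, c.repForm x (curvature D.conn x (coordBasis x i) X Y) (d i) := fun D =>
    Finset.sum_congr rfl fun i _ => hd i _
  have h := hκ X Y
  have h2 : ∑ i, c.repForm x (curvature D'.conn x (coordBasis x i) X Y) (d i) =
      ∑ i, c.repForm x (curvature D.conn x (coordBasis x i) X Y) (d i) + _ :=
    (Finset.sum_congr rfl fun i _ => (D.repForm_curvature_diff D' x _ X Y _).trans
      (by rw [add_sub_assoc, add_sub_assoc, add_assoc])).trans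
        Finset.sum_add_distrib
  rw [hric, hric, h2]
  simp only [add_assoc, add_sub_assoc] at h ⊢
  rw [h]
  ring

end WeylStructure
end Change

/-! ### The Hessian of a section of `L` -/

section Hessian

variable {m : ℕ} {M : Type*} [TopologicalSpace M] [ChartedSpace (Model m) M]
  [IsManifold (𝓡 m) ∞ M]

variable {c : ConformalStructure m M}

namespace WeylStructure

variable (D D' : WeylStructure c)

/-- The connection matrix in the coordinate frame `e` at `x`, contracted with a vector field that
is constant in the chart: `∇_Y e_i = ∑ ω_i^j(Y) e_j`. -/
noncomputable def connMatrix (x : M) (Y : TangentSpace (𝓡 m) x) (i j : Fin m) : M → ℝ :=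
  frameCoord x j fun y => D.conn (coordFrame x i) y (FiberBundle.extend (Model m) Y y)

theorem connMatrix_self (x : M) (Y : TangentSpace (𝓡 m) x) (i j : Fin m) :
    D.connMatrix x Y i j x = (coordBasis x).coord j (D.conn (coordFrame x i) x Y) := by
  have hx := mem_chart_source (Model m) x
  have h : frameBasis x x hx = coordBasis x := Module.Basis.eq_of_apply_eq fun i => by
    rw [frameBasis_apply, coordFrame_self]
  rw [connMatrix, ← frameBasis_coord hx, h, FiberBundle.extend_apply_self]

theorem mdifferentiableAt_connMatrix [T2Space M] (x : M) (Y : TangentSpace (𝓡 m) x) (i j : Fin m) :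
    MDifferentiableAt (𝓡 m) 𝓘(ℝ, ℝ) (D.connMatrix x Y i j) x :=
  mdifferentiableAt_frameCoord (mem_chart_source (Model m) x)
    (mdifferentiableAt_cov_extend D.conn D.smooth (coordBasis x i) Y) j

/-- The connection form of `L` in the coordinate frame at `x`, contracted with a vector field that
is constant in the chart. -/
noncomputable def lineFormExtend (x : M) (Y : TangentSpace (𝓡 m) x) (y : M) : ℝ :=
  1 / (m : ℝ) * ∑ i, D.connMatrix x Y i i y

theorem lineFormExtend_self (x : M) (Y : TangentSpace (𝓡 m) x) :
    D.lineFormExtend x Y x = D.lineForm x Y := by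
  simp only [lineFormExtend, connMatrix_self, lineForm_apply, connTrace]

theorem mvfderiv_lineFormExtend [T2Space M] (x : M) (X Y : TangentSpace (𝓡 m) x) :
    MDifferentiableAt (𝓡 m) 𝓘(ℝ, ℝ) (D.lineFormExtend x Y) x ∧
    mvfderiv (𝓡 m) (D.lineFormExtend x Y) x X =
      1 / (m : ℝ) * ∑ i, mvfderiv (𝓡 m) (D.connMatrix x Y i i) x X := by
  have h1 := mvfderiv_sum Finset.univ (fun i _ => D.mdifferentiableAt_connMatrix x Y i i) X
  have h2 : D.lineFormExtend x Y =
      fun y => (fun _ => 1 / (m : ℝ)) y * ∑ i, D.connMatrix x Y i i y := rfl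
  refine ⟨h2 ▸ (mdifferentiableAt_const).mul h1.2, ?_⟩
  rw [h2, mvfderiv_fun_mul mdifferentiableAt_const h1.2, mvfderiv_const]
  simp only [smul_zero, add_zero, smul_apply, h1.1, smul_eq_mul]

/-- The Faraday form is the curvature of the connection induced on `L`. -/
theorem faraday_eq [T2Space M] (x : M) (X Y : TangentSpace (𝓡 m) x) :
    faraday D.conn x X Y =
      mvfderiv (𝓡 m) (D.lineFormExtend x Y) x X - mvfderiv (𝓡 m) (D.lineFormExtend x X) x Y := by
  have hx := mem_chart_source (Model m) x
  have key : ∀ (X Y : TangentSpace (𝓡 m) x) (i : Fin m), (coordBasis x).coord i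
      (D.conn (fun y => D.conn (FiberBundle.extend (Model m) (coordBasis x i)) y
        (FiberBundle.extend (Model m) Y y)) x X) =
      ∑ j, D.connMatrix x Y i j x * D.connMatrix x X j i x +
        mvfderiv (𝓡 m) (D.connMatrix x Y i i) x X := by
    intro X Y i
    have h1 := cov_sum D.conn.isCovariantDerivativeOnUniv Finset.univ
      (f := fun j => D.connMatrix x Y i j) (σ := coordFrame x) (Set.mem_univ x)
      (fun j => D.mdifferentiableAt_connMatrix x Y i j)
      (fun j => mdifferentiableAt_extend_of_mem _ hx) X
    have h2 := D.conn.isCovariantDerivativeOnUniv.congr_of_eventuallyEq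
      (mdifferentiableAt_cov_extend D.conn D.smooth (coordBasis x i) Y) h1.2 Filter.univ_mem (by
        filter_upwards [chart_source_eventually (m := m) x] with y hy
        exact eq_sum_frameCoord hy fun y => D.conn (coordFrame x i) y
          (FiberBundle.extend (Model m) Y y))
    rw [h2, h1.1, map_sum]
    simp only [map_add, map_smul, smul_eq_mul, Finset.sum_add_distrib, connMatrix_self]
    congr 1
    simp only [coordFrame_self, Module.Basis.coord_apply, Module.Basis.repr_self,
      Finsupp.single_apply]
    simp
  have hR : ∀ i, (coordBasis x).coord i (curvature D.conn x X Y (coordBasis x i)) = _ := fun i => by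
    rw [curvature_eq, map_sub, key, key]
  rw [(D.mvfderiv_lineFormExtend x X Y).2, (D.mvfderiv_lineFormExtend x Y X).2, faraday]
  simp only [hR, Finset.sum_sub_distrib, Finset.sum_add_distrib]
  have hs : ∑ i, ∑ j, D.connMatrix x Y i j x * D.connMatrix x X j i x =
      ∑ i, ∑ j, D.connMatrix x X i j x * D.connMatrix x Y j i x := by
    rw [Finset.sum_comm]
    exact Finset.sum_congr rfl fun i _ => Finset.sum_congr rfl fun j _ => mul_comm _ _
  rw [hs]
  ring

variable {l : ∀ x : M, weightSpace m 1 (TangentSpace (𝓡 m) x)} {x : M}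

/-- The derivative of a section of `L` along a coordinate vector field, in the coordinate frame. -/
theorem covWeight_extend_eventuallyEq (hl : ∀ᶠ y in 𝓝 x, SmoothWeightAt 1 l y)
    (Y : TangentSpace (𝓡 m) x) :
    (fun y => (covWeight 1 D.conn l y (FiberBundle.extend (Model m) Y y)).1
      (fun i => coordFrame x i y)) =ᶠ[𝓝 x] fun y =>
      mvfderiv (𝓡 m) (fun z => (l z).1 (fun i => coordFrame x i z)) y
        (FiberBundle.extend (Model m) Y y) +
      D.lineFormExtend x Y y * (l y).1 (fun i => coordFrame x i y) := by
  filter_upwards [hl, chart_source_eventually (m := m) x] with y hly hy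
  rw [covWeight_apply_frame D.conn 1 l x y hy (hly.mdifferentiableAt (by simp))]
  rfl

theorem mvfderiv_covWeight_extend [T2Space M] (hl : ∀ᶠ y in 𝓝 x, SmoothWeightAt 1 l y)
    (X Y : TangentSpace (𝓡 m) x) :
    MDifferentiableAt (𝓡 m) 𝓘(ℝ, ℝ) (fun y => (covWeight 1 D.conn l y
      (FiberBundle.extend (Model m) Y y)).1 (fun i => coordFrame x i y)) x ∧
    mvfderiv (𝓡 m) (fun y => (covWeight 1 D.conn l y
      (FiberBundle.extend (Model m) Y y)).1 (fun i => coordFrame x i y)) x X =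
    mvfderiv (𝓡 m) (fun y => mvfderiv (𝓡 m) (fun z => (l z).1 (fun i => coordFrame x i z)) y
        (FiberBundle.extend (Model m) Y y)) x X +
      (D.lineForm x Y * mvfderiv (𝓡 m) (fun z => (l z).1 (fun i => coordFrame x i z)) x X +
        (l x).1 (coordBasis x) * mvfderiv (𝓡 m) (D.lineFormExtend x Y) x X) := by
  have hlx := hl.self_of_nhds
  have h1 := (mvfderiv_mvfderiv_extend hlx X Y).1
  have h2 := (D.mvfderiv_lineFormExtend x X Y).1
  have h3 : MDifferentiableAt (𝓡 m) 𝓘(ℝ, ℝ) (fun z => (l z).1 (fun i => coordFrame x i z)) x :=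
    hlx.mdifferentiableAt (by simp)
  have h4 : MDifferentiableAt (𝓡 m) 𝓘(ℝ, ℝ) (fun y => D.lineFormExtend x Y y *
    (l y).1 (fun i => coordFrame x i y)) x := h2.mul h3
  have he := D.covWeight_extend_eventuallyEq hl Y
  refine ⟨(h1.add h4).congr_of_eventuallyEq he, ?_⟩
  rw [mvfderiv_congr he, mvfderiv_fun_add h1 h4, mvfderiv_fun_mul h2 h3]
  simp only [add_apply, smul_apply, smul_eq_mul, lineFormExtend_self, coe_coordBasis]

/-- The Hessian is symmetric up to the Faraday form. -/
theorem hess_sub_hess [T2Space M] (hl : ∀ᶠ y in 𝓝 x, SmoothWeightAt 1 l y)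
    (X Y : TangentSpace (𝓡 m) x) :
    hess D.conn l x X Y - hess D.conn l x Y X = faraday D.conn x X Y • l x := by
  refine weightSpace_ext (coordBasis x) ?_
  simp only [hess, D.cov_extend_comm X Y]
  change ((covWeight 1 D.conn _ x X).1 (coordBasis x) - (covWeight 1 D.conn _ x _).1 (coordBasis x))
    - ((covWeight 1 D.conn _ x Y).1 (coordBasis x) - (covWeight 1 D.conn _ x _).1 (coordBasis x))
    = faraday D.conn x X Y * (l x).1 (coordBasis x)
  simp only [D.covWeight_apply, (D.mvfderiv_covWeight_extend hl _ _).2, D.faraday_eq,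
    FiberBundle.extend_apply_self, mvfderiv_mvfderiv_extend_comm hl.self_of_nhds X Y]
  ring

/-- The covariant derivative of a section of `L`, as a linear map. -/
noncomputable def covWeightₗ (l : ∀ x : M, weightSpace m 1 (TangentSpace (𝓡 m) x)) (x : M) :
    TangentSpace (𝓡 m) x →ₗ[ℝ] weightSpace m 1 (TangentSpace (𝓡 m) x) where
  toFun := covWeight 1 D.conn l x
  map_add' X Y := weightSpace_ext (coordBasis x) <| by
    change _ = (covWeight 1 D.conn l x X).1 (coordBasis x) + (covWeight 1 D.conn l x Y).1 (coordBasis x)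
    simp only [D.covWeight_apply, map_add]
    ring
  map_smul' a X := weightSpace_ext (coordBasis x) <| by
    change _ = a * (covWeight 1 D.conn l x X).1 (coordBasis x)
    simp only [D.covWeight_apply, map_smul, smul_eq_mul]
    ring

theorem covWeightₗ_apply (l : ∀ x : M, weightSpace m 1 (TangentSpace (𝓡 m) x)) (x : M)
    (X : TangentSpace (𝓡 m) x) : D.covWeightₗ l x X = covWeight 1 D.conn l x X := rfl

/-- The difference of two Weyl structures as a vector; `v` is the vector dual to the one-form. -/
theorem exists_diff_eq (x : M) : ∃ v : TangentSpace (𝓡 m) x, ∀ X Y, D.diff D' x X Y =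
    D.diffForm D' x X • Y + D.diffForm D' x Y • X - c.repForm x X Y • v := by
  have hg := c.isScalarProduct x
  obtain ⟨d, -, hd, -⟩ := hg.exists_dual (coordBasis x)
  refine ⟨∑ i, D.diffForm D' x (coordBasis x i) • d i, fun X Y => hg.eq_of_forall fun Z => ?_⟩
  have hv : c.repForm x (∑ i, D.diffForm D' x (coordBasis x i) • d i) Z = D.diffForm D' x Z := by
    conv_rhs => rw [← hd Z, map_sum]
    rw [map_sum, LinearMap.sum_apply]
    refine Finset.sum_congr rfl fun i _ => ?_
    rw [map_smul, map_smul, LinearMap.smul_apply, smul_eq_mul, smul_eq_mul, hg.symm, mul_comm]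
  rw [D.repForm_diff D', map_sub, map_add, map_smul, map_smul, map_smul]
  simp only [LinearMap.add_apply, LinearMap.sub_apply, LinearMap.smul_apply, smul_eq_mul, hv]
  ring

/-- The change of the Hessian, up to multiples of the metric. -/
theorem exists_hess_diff [T2Space M] (hl : ∀ᶠ y in 𝓝 x, SmoothWeightAt 1 l y) :
    ∃ a : weightSpace m 1 (TangentSpace (𝓡 m) x), ∀ X Y : TangentSpace (𝓡 m) x,
      hess D'.conn l x X Y = hess D.conn l x X Y +
        (D.covDiffForm D' x X Y - D.diffForm D' x X * D.diffForm D' x Y) • l x +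
          c.repForm x X Y • a := by
  have hx := mem_chart_source (Model m) x
  obtain ⟨v, hv⟩ := D.exists_diff_eq D' x
  refine ⟨D.covWeightₗ l x v + D.diffForm D' x v • l x, fun X Y => ?_⟩
  have hlx : MDifferentiableAt (𝓡 m) 𝓘(ℝ, ℝ) (fun z => (l z).1 (fun i => coordFrame x i z)) x :=
    hl.self_of_nhds.mdifferentiableAt (by simp)
  have h1 : covWeight 1 D.conn (fun y => covWeight 1 D'.conn l y
      (FiberBundle.extend (Model m) Y y)) x X = covWeight 1 D.conn (fun y => covWeight 1 D.conn l y
      (FiberBundle.extend (Model m) Y y)) x X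
      + mvfderiv (𝓡 m) (fun y => D.diffForm D' y (FiberBundle.extend (Model m) Y y)) x X • l x
      + D.diffForm D' x Y • covWeight 1 D.conn l x X := by
    refine weightSpace_ext (coordBasis x) ?_
    change _ = (covWeight 1 D.conn _ x X).1 (coordBasis x) + _ * (l x).1 (coordBasis x)
      + _ * (covWeight 1 D.conn l x X).1 (coordBasis x)
    have he : (fun y => (covWeight 1 D'.conn l y (FiberBundle.extend (Model m) Y y)).1
        (fun i => coordFrame x i y)) = fun y => (covWeight 1 D.conn l y
          (FiberBundle.extend (Model m) Y y)).1 (fun i => coordFrame x i y) +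
          D.diffForm D' y (FiberBundle.extend (Model m) Y y) * (l y).1 (fun i => coordFrame x i y) := by
      funext y
      rw [D.covWeight_diff D', one_mul]
      rfl
    have hf := D.mdifferentiableAt_diffForm_extend D' Y
    have h4 : MDifferentiableAt (𝓡 m) 𝓘(ℝ, ℝ) (fun y => D.diffForm D' y
      (FiberBundle.extend (Model m) Y y) * (l y).1 (fun i => coordFrame x i y)) x := hf.mul hlx
    simp only [D.covWeight_apply]
    rw [he, mvfderiv_fun_add (D.mvfderiv_covWeight_extend hl X Y).1 h4, mvfderiv_fun_mul hf hlx]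
    simp only [add_apply, smul_apply, smul_eq_mul, FiberBundle.extend_apply_self, ← coe_coordBasis,
      D.covWeight_diff D']
    change _ + 1 * D.lineForm x X * ((covWeight 1 D.conn l x Y).1 (coordBasis x)
      + 1 * D.diffForm D' x Y * (l x).1 (coordBasis x)) = _
    rw [D.covWeight_apply]
    ring
  have hcov := D.diff_apply D' (mdifferentiableAt_extend_of_mem Y hx) X
  rw [FiberBundle.extend_apply_self, D.diff_symm D', hv] at hcov
  simp only [hess]
  rw [D.covWeight_diff D' 1 _ x X, D.covWeight_diff D' 1 l x, h1, hcov,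
    D.covWeight_diff D' 1 l x, FiberBundle.extend_apply_self, D.covDiffForm_apply]
  simp only [← covWeightₗ_apply, map_add, map_sub, map_smul, smul_eq_mul]
  module

end WeylStructure

end Hessian

/-! ### Invariance of the Möbius operator -/

section Moebius

variable {m : ℕ} {M : Type*} [TopologicalSpace M] [ChartedSpace (Model m) M]
  [IsManifold (𝓡 m) ∞ M] {c : ConformalStructure m M}

theorem faraday_antisymm (D : Conn m M) (x : M) (X Y : TangentSpace (𝓡 m) x) :
    faraday D x X Y = - faraday D x Y X := by
  simp only [faraday]
  rw [← mul_neg, ← Finset.sum_neg_distrib]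
  congr 1
  exact Finset.sum_congr rfl fun i _ => by rw [curvature_antisymm, map_neg]

/-- The Schouten-Weyl tensor, up to multiples of the metric. -/
theorem exists_schouten_eq (c : ConformalStructure m M) (D : Conn m M) (x : M) :
    ∃ a : ℝ, ∀ X Y : TangentSpace (𝓡 m) x, schouten c D x X Y =
      1 / ((m : ℝ) - 2) * symPart (ricci D x) X Y - 1 / 2 * faraday D x X Y +
        c.repForm x X Y * a :=
  ⟨1 / (2 * (m : ℝ) * ((m : ℝ) - 1)) * bilinTrace (c.rep x) (coordBasis x) (ricci D x)
    - 1 / ((m : ℝ) - 2) * (1 / (m : ℝ) *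
      bilinTrace (c.rep x) (coordBasis x) (symPart (ricci D x))), fun X Y => by
    simp only [schouten, traceFree, smul_eq_mul, c.repForm_apply]
    ring⟩

theorem exists_symPart_schouten_eq (c : ConformalStructure m M) (D : Conn m M) (x : M) :
    ∃ a : ℝ, ∀ X Y : TangentSpace (𝓡 m) x, symPart (schouten c D x) X Y =
      1 / ((m : ℝ) - 2) * symPart (ricci D x) X Y + c.repForm x X Y * a := by
  obtain ⟨a, ha⟩ := exists_schouten_eq c D x
  refine ⟨a, fun X Y => ?_⟩
  have h1 := faraday_antisymm D x X Y
  have h2 := (c.isScalarProduct x).symm X Y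
  rw [symPart, ha X Y, ha Y X, ← h2, h1]
  simp only [symPart, smul_eq_mul]
  ring

/-- The canonical Möbius operator is the trace-free part of the symmetrized Hessian plus a multiple
of the symmetrized Ricci tensor. -/
theorem mobius_eq_traceFree (hm : m ≠ 0) (D : WeylStructure c)
    (l : ∀ x : M, weightSpace m 1 (TangentSpace (𝓡 m) x)) (x : M) :
    mobius c D l x = traceFree (fun X Y => c.repForm x X Y) (coordBasis x) fun X Y =>
      symPart (hess D.conn l x) X Y + (1 / ((m : ℝ) - 2) * symPart (ricci D.conn x) X Y) • l x := by
  obtain ⟨a, ha⟩ := exists_symPart_schouten_eq c D.conn x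
  have h := (c.isScalarProduct x).traceFree_congr (coordBasis x) hm
    (B := fun X Y => symPart (hess D.conn l x) X Y +
      (1 / ((m : ℝ) - 2) * symPart (ricci D.conn x) X Y) • l x)
    (B' := fun X Y => symPart (hess D.conn l x) X Y + symPart (schouten c D.conn x) X Y • l x)
    (a := a • l x) (fun X Y => by rw [ha]; module)
  rw [← h]
  funext X Y
  rw [traceFree_add]
  have h2 := traceFree_map (fun X Y => c.repForm x X Y) (coordBasis x)
    (symPart (schouten c D.conn x)) (LinearMap.toSpanSingleton ℝ _ (l x)) X Y
  simp only [LinearMap.toSpanSingleton_apply] at h2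
  rw [h2]
  rfl

/-- The Möbius operator, up to multiples of the metric. -/
theorem exists_mobius_eq (D : WeylStructure c) (hm : m ≠ 0)
    (l : ∀ x : M, weightSpace m 1 (TangentSpace (𝓡 m) x)) (x : M) :
    ∃ a : weightSpace m 1 (TangentSpace (𝓡 m) x), ∀ X Y : TangentSpace (𝓡 m) x,
      mobius c D l x X Y = symPart (hess D.conn l x) X Y +
        (1 / ((m : ℝ) - 2) * symPart (ricci D.conn x) X Y) • l x + c.repForm x X Y • a := by
  rw [mobius_eq_traceFree hm]
  generalize hB : (fun X Y => symPart (hess D.conn l x) X Y +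
    (1 / ((m : ℝ) - 2) * symPart (ricci D.conn x) X Y) • l x) = B
  refine ⟨-((1 / (m : ℝ)) • bilinTrace (fun X Y => c.repForm x X Y) (coordBasis x) B),
    fun X Y => ?_⟩
  rw [← hB]
  simp only [traceFree, mul_smul]
  module

namespace WeylStructure

variable [T2Space M] (D D' : WeylStructure c)
  {l : ∀ x : M, weightSpace m 1 (TangentSpace (𝓡 m) x)} {x : M}

/-- The canonical Möbius operator does not depend on the Weyl structure: the change
`β^s - γ ⊗ γ` of the Hessian is compensated by the change of the Ricci tensor. -/
theorem mobius_eq (hm : 2 < m) (hl : ∀ᶠ y in 𝓝 x, SmoothWeightAt 1 l y) :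
    mobius c D' l x = mobius c D l x := by
  have hm0 : m ≠ 0 := by omega
  obtain ⟨κ, hκ⟩ := D.exists_ricci_diff D' x
  obtain ⟨a, ha⟩ := D.exists_hess_diff D' hl
  rw [mobius_eq_traceFree hm0, mobius_eq_traceFree hm0]
  refine (c.isScalarProduct x).traceFree_congr (coordBasis x) hm0
    (a := a + (1 / ((m : ℝ) - 2) * κ) • l x) fun X Y => ?_
  have hm2 : (m : ℝ) - 2 ≠ 0 := by
    have : (2 : ℝ) < m := by exact_mod_cast hm
    linarith
  have hR : 1 / ((m : ℝ) - 2) * symPart (ricci D'.conn x) X Y =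
      1 / ((m : ℝ) - 2) * symPart (ricci D.conn x) X Y
      - (1 / 2 * (D.covDiffForm D' x X Y + D.covDiffForm D' x Y X)
        - D.diffForm D' x X * D.diffForm D' x Y) + c.repForm x X Y * (1 / ((m : ℝ) - 2) * κ) := by
    simp only [symPart, smul_eq_mul, hκ, (c.isScalarProduct x).symm Y X]
    field_simp
    ring
  rw [hR]
  simp only [symPart, ha, (c.isScalarProduct x).symm Y X]
  module

/-- The Hessian plus the Schouten-Weyl tensor represents the Möbius operator: the antisymmetric
part of the Hessian cancels the Faraday form in the Schouten-Weyl tensor. -/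
theorem exists_hess_add_schouten_eq (hm : m ≠ 0) (hl : ∀ᶠ y in 𝓝 x, SmoothWeightAt 1 l y) :
    ∃ a : weightSpace m 1 (TangentSpace (𝓡 m) x), ∀ X Y : TangentSpace (𝓡 m) x,
      hess D.conn l x X Y + schouten c D.conn x X Y • l x =
        mobius c D l x X Y + c.repForm x X Y • a := by
  obtain ⟨a, ha⟩ := exists_mobius_eq D hm l x
  obtain ⟨b, hb⟩ := exists_schouten_eq c D.conn x
  refine ⟨b • l x - a, fun X Y => ?_⟩
  have h := D.hess_sub_hess hl X Y
  have h2 : hess D.conn l x X Y =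
      symPart (hess D.conn l x) X Y + (1 / 2 * faraday D.conn x X Y) • l x := by
    rw [mul_smul, ← h]
    simp only [symPart]
    module
  rw [ha, hb, h2]
  module

end WeylStructure

end Moebius

/-! ### Submanifolds -/

section Submanifold

variable {m n : ℕ} {M : Type*} [TopologicalSpace M] [ChartedSpace (Model m) M]
  [IsManifold (𝓡 m) ∞ M]
  {N : Type*} [TopologicalSpace N] [ChartedSpace (Model n) N] [IsManifold (𝓡 n) ∞ N]
  {c : ConformalStructure m M} {ι : N → M}

/-- The induced scalar product on `T_p N` as a bilinear form. -/
noncomputable def ConformalStructure.repNForm (c : ConformalStructure m M) (ι : N → M) (p : N) :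
    LinearMap.BilinForm ℝ (TangentSpace (𝓡 n) p) :=
  (c.repForm (ι p)).compl₁₂ (dmap n ι p).toLinearMap (dmap n ι p).toLinearMap

omit [IsManifold (𝓡 n) ∞ N] in
theorem ConformalStructure.repNForm_apply (c : ConformalStructure m M) (ι : N → M) (p : N)
    (X Y : TangentSpace (𝓡 n) p) :
    c.repNForm ι p X Y = c.repForm (ι p) (dmap n ι p X) (dmap n ι p Y) := rfl

omit [IsManifold (𝓡 n) ∞ N] in
theorem ConformalStructure.isScalarProduct_repNForm (c : ConformalStructure m M) {p : N}
    (hp : Function.Injective (dmap (m := m) n ι p)) : IsScalarProduct (c.repNForm (n := n) ι p) where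
  symm _ _ := (c.isScalarProduct (ι p)).symm _ _
  pos _ hX := (c.isScalarProduct (ι p)).pos _ fun h => hX (hp (h.trans (map_zero _).symm))

omit [IsManifold (𝓡 n) ∞ N] in
/-- The tangential component is the orthogonal projection to `TN`. -/
theorem repForm_tangPart {p : N} (hp : Function.Injective (dmap (m := m) n ι p))
    (V : TangentSpace (𝓡 m) (ι p)) (Z : TangentSpace (𝓡 n) p) :
    c.repForm (ι p) (dmap n ι p (tangPart c ι p V)) (dmap n ι p Z) =
      c.repForm (ι p) V (dmap n ι p Z) :=
  (c.isScalarProduct_repNForm hp).gram_inv_sum (g' := c.repForm (ι p))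
    (j := (dmap n ι p).toLinearMap) (c.repNForm_apply ι p) (coordBasis p) V Z

theorem repForm_fundForm_dmap {p : N} (hp : Function.Injective (dmap (m := m) n ι p))
    (D : Conn m M) (X Y Z : TangentSpace (𝓡 n) p) :
    c.repForm (ι p) (fundForm c D ι p X Y) (dmap n ι p Z) = 0 := by
  rw [fundForm, map_sub, LinearMap.sub_apply, repForm_tangPart hp, sub_self]

theorem repForm_fundForm₀_dmap {p : N} (hp : Function.Injective (dmap (m := m) n ι p))
    (D : Conn m M) (X Y Z : TangentSpace (𝓡 n) p) :
    c.repForm (ι p) (fundForm₀ c D ι p X Y) (dmap n ι p Z) = 0 := by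
  have h := traceFree_map (repN (n := n) c ι p) (coordBasis (m := n) p) (fundForm c D ι p)
    (LinearMap.flip (c.repForm (ι p)) (dmap n ι p Z)) X Y
  simp only [LinearMap.flip_apply, repForm_fundForm_dmap hp] at h
  rw [fundForm₀, ← h]
  simp [traceFree, bilinTrace]

omit [IsManifold (𝓡 m) ∞ M] [IsManifold (𝓡 n) ∞ N] in
theorem mvfderiv_comp_dmap {f : M → ℝ} {p : N} (hf : MDifferentiableAt (𝓡 m) 𝓘(ℝ, ℝ) f (ι p))
    (hι : MDifferentiableAt (𝓡 n) (𝓡 m) ι p) (X : TangentSpace (𝓡 n) p) :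
    mvfderiv (𝓡 n) (fun q => f (ι q)) p X = mvfderiv (𝓡 m) f (ι p) (dmap n ι p X) := by
  have h := (hf.hasMFDerivAt.comp p hι.hasMFDerivAt).mfderiv
  have h2 : mfderiv (𝓡 n) 𝓘(ℝ, ℝ) (fun q => f (ι q)) p = _ := h
  unfold mvfderiv
  rw [h2]
  rfl

omit [IsManifold (𝓡 n) ∞ N] in
/-- The derivative along `N` of the restriction to `N` of a section of `L` over `M`. -/
theorem covWeightAlong_eq (D : Conn m M) {l : ∀ q : N, weightSpace m 1 (TangentSpace (𝓡 m) (ι q))}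
    {lM : ∀ x : M, weightSpace m 1 (TangentSpace (𝓡 m) x)} (hl : ∀ q, lM (ι q) = l q) {p : N}
    (hs : SmoothWeightAt 1 lM (ι p)) (hι : MDifferentiableAt (𝓡 n) (𝓡 m) ι p)
    (X : TangentSpace (𝓡 n) p) :
    covWeightAlong D ι l p X = covWeight 1 D lM (ι p) (dmap n ι p X) := by
  simp only [covWeightAlong, covWeight, ← hl]
  refine congrArg (fun r => weightOfBasis 1 (coordBasis (ι p)) (r + _)) ?_
  exact mvfderiv_comp_dmap (f := fun y => (lM y).1 (fun i => coordFrame (ι p) i y))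
    (hs.mdifferentiableAt (by simp)) hι X

/-- The image under `dι` of a coordinate vector field of `N` has smooth components in the chart
of `M`. -/
theorem contMDiffAt_dmap_extend (hι : ContMDiff (𝓡 n) (𝓡 m) ∞ ι) (p : N)
    (Y : TangentSpace (𝓡 n) p) :
    ContMDiffAt (𝓡 n) 𝓘(ℝ, Model m) ∞ (fun q => (trivializationAt (Model m)
      (TangentSpace (𝓡 m) : M → Type _) (ι p) (⟨ι q, dmap n ι q
        (FiberBundle.extend (Model n) Y q)⟩ : TangentBundle (𝓡 m) M)).2) p := by
  have h1 : ContMDiff (𝓡 n).tangent (𝓡 m).tangent ∞ (tangentMap (𝓡 n) (𝓡 m) ι) :=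
    hι.contMDiff_tangentMap (by simp)
  have h2 := contMDiffAt_extend_of_mem Y (mem_chart_source (Model n) p)
  have h3 := (h1 _).comp p h2
  exact (Bundle.contMDiffAt_totalSpace.1 h3).2

namespace WeylStructure

variable (D : WeylStructure c)

/-- The second derivative along `N` of the restriction of a section of `L`: a vector field tangent
to `N` is expanded in the coordinate frame of `M`, and its components are differentiated along
`N`. -/
theorem covWeightAlong_covWeight [T2Space M] (hι : ContMDiff (𝓡 n) (𝓡 m) ∞ ι)
    {lM : ∀ x : M, weightSpace m 1 (TangentSpace (𝓡 m) x)} {p : N}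
    (hl : ∀ᶠ y in 𝓝 (ι p), SmoothWeightAt 1 lM y) (X Y : TangentSpace (𝓡 n) p) :
    covWeightAlong D.conn ι (fun q => covWeight 1 D.conn lM (ι q)
      (dmap n ι q (FiberBundle.extend (Model n) Y q))) p X =
    hess D.conn lM (ι p) (dmap n ι p X) (dmap n ι p Y) +
      covWeight 1 D.conn lM (ι p) (covTangent D.conn ι p X Y) := by
  have hx := mem_chart_source (Model m) (ι p)
  have hιp : MDifferentiableAt (𝓡 n) (𝓡 m) ι p := (hι p).mdifferentiableAt (by simp)
  set v : N → Model m := fun q => (trivializationAt (Model m)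
      (TangentSpace (𝓡 m) : M → Type _) (ι p) (⟨ι q, dmap n ι q
        (FiberBundle.extend (Model n) Y q)⟩ : TangentBundle (𝓡 m) M)).2
  have hvd : MDifferentiableAt (𝓡 n) 𝓘(ℝ, Model m) v p :=
    (contMDiffAt_dmap_extend hι p Y).mdifferentiableAt (by simp)
  have hvi : ∀ i, MDifferentiableAt (𝓡 n) 𝓘(ℝ, ℝ) (fun q => v q i) p := fun i =>
    mdifferentiableAt_comp_of_hasFDerivAt (f := v) (g := fun z : Model m => z i)
      (EuclideanSpace.proj i : Model m →L[ℝ] ℝ).hasFDerivAt hvd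
  have hvX : ∀ i, mvfderiv (𝓡 n) (fun q => v q i) p X = (mvfderiv (𝓡 n) v p X : Model m) i :=
    fun i => mvfderiv_comp_of_hasFDerivAt (f := v) (g := fun z : Model m => z i)
      (EuclideanSpace.proj i : Model m →L[ℝ] ℝ).hasFDerivAt hvd X
  set ψ : Fin m → M → ℝ := fun i y => (covWeight 1 D.conn lM y (coordFrame (ι p) i y)).1
    (fun i => coordFrame (ι p) i y)
  have hψd : ∀ i, MDifferentiableAt (𝓡 m) 𝓘(ℝ, ℝ) (ψ i) (ι p) := fun i =>
    (D.mvfderiv_covWeight_extend hl (dmap n ι p X) (coordBasis (ι p) i)).1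
  have hψι : ∀ i, MDifferentiableAt (𝓡 n) 𝓘(ℝ, ℝ) (fun q => ψ i (ι q)) p := fun i =>
    (hψd i).comp p hιp
  -- the section along `N` in terms of the coordinate frame
  have hW : ∀ (y : M) (hy : y ∈ (chartAt (Model m) (ι p)).source) (V : TangentSpace (𝓡 m) y),
      (covWeight 1 D.conn lM y V).1 (fun i => coordFrame (ι p) i y) =
        ∑ i, (frameBasis (ι p) y hy).coord i V * ψ i y := by
    intro y hy V
    conv_lhs => rw [← (frameBasis (ι p) y hy).sum_repr V]
    rw [← covWeightₗ_apply, map_sum]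
    simp only [map_smul, Submodule.coe_sum, Finset.sum_apply, Submodule.coe_smul, Pi.smul_apply,
      smul_eq_mul, frameBasis_apply]
    rfl
  -- near `p` the point `ι q` stays in the chart at `ι p`, where the expansion holds
  have he1 : (fun q => (covWeight 1 D.conn lM (ι q) (dmap n ι q
      (FiberBundle.extend (Model n) Y q))).1 (fun i => coordFrame (ι p) i (ι q))) =ᶠ[𝓝 p]
      fun q => ∑ i, v q i * ψ i (ι q) := by
    filter_upwards [hιp.continuousAt.eventually (chart_source_eventually (m := m) (ι p))] with q hq
    rw [hW _ hq]
    rfl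
  have hbasis : frameBasis (ι p) (ι p) hx = coordBasis (ι p) := Module.Basis.eq_of_apply_eq
    fun i => by rw [frameBasis_apply, coordFrame_self]
  have hvp : ∀ i, v p i = (coordBasis (ι p)).coord i (dmap n ι p Y) := by
    intro i
    have h : v p i = (frameBasis (ι p) (ι p) hx).coord i
      (dmap n ι p (FiberBundle.extend (Model n) Y p)) := rfl
    rw [h, hbasis, FiberBundle.extend_apply_self]
  have he2 : (fun y => (covWeight 1 D.conn lM y (FiberBundle.extend (Model m) (dmap n ι p Y) y)).1
      (fun i => coordFrame (ι p) i y)) =ᶠ[𝓝 (ι p)] fun y => ∑ i, (fun _ => v p i) y * ψ i y := by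
    filter_upwards [chart_source_eventually (m := m) (ι p)] with y hy
    rw [extend_eq_sum hy (dmap n ι p Y), ← covWeightₗ_apply, map_sum]
    simp only [map_smul, Submodule.coe_sum, Finset.sum_apply, Submodule.coe_smul, Pi.smul_apply,
      smul_eq_mul, hvp]
    rfl
  have hd1 : mvfderiv (𝓡 n) (fun q => ∑ i, v q i * ψ i (ι q)) p X =
      ∑ i, (v p i * mvfderiv (𝓡 m) (ψ i) (ι p) (dmap n ι p X) +
        ψ i (ι p) * (mvfderiv (𝓡 n) v p X : Model m) i) := by
    rw [(mvfderiv_sum Finset.univ (f := fun i q => v q i * ψ i (ι q))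
      (fun i _ => (hvi i).mul (hψι i)) X).1]
    refine Finset.sum_congr rfl fun i _ => ?_
    rw [mvfderiv_fun_mul (hvi i) (hψι i)]
    simp only [add_apply, smul_apply, smul_eq_mul, mvfderiv_comp_dmap (hψd i) hιp, hvX]
  have hd2 : mvfderiv (𝓡 m) (fun y => ∑ i, (fun _ => v p i) y * ψ i y) (ι p) (dmap n ι p X) =
      ∑ i, v p i * mvfderiv (𝓡 m) (ψ i) (ι p) (dmap n ι p X) := by
    rw [(mvfderiv_sum Finset.univ (f := fun i y => (fun _ => v p i) y * ψ i y)
      (fun i _ => mdifferentiableAt_const.mul (hψd i)) (dmap n ι p X)).1]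
    refine Finset.sum_congr rfl fun i _ => ?_
    rw [mvfderiv_fun_mul mdifferentiableAt_const (hψd i), mvfderiv_const]
    simp only [smul_zero, add_zero, smul_apply, smul_eq_mul]
  set T : TangentSpace (𝓡 m) (ι p) := mvfderiv (𝓡 n) v p X
  have hTv : (covWeight 1 D.conn lM (ι p) T).1 (coordBasis (ι p)) =
      ∑ i, ψ i (ι p) * (mvfderiv (𝓡 n) v p X : Model m) i := by
    rw [coe_coordBasis, hW _ hx, hbasis]
    exact Finset.sum_congr rfl fun i _ => mul_comm _ _
  have hcov : covTangent D.conn ι p X Y =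
      T + D.conn (FiberBundle.extend (Model m) (dmap n ι p Y)) (ι p) (dmap n ι p X) := by
    have h := FiberBundle.extend_apply_self (F := Model n) Y
    simp only [covTangent, covAlong, h]
    rfl
  refine weightSpace_ext (coordBasis (ι p)) ?_
  rw [hcov, ← covWeightₗ_apply D lM (ι p) (T + _), map_add]
  simp only [covWeightₗ_apply, hess, sub_add]
  change _ = (covWeight 1 D.conn _ _ _).1 (coordBasis (ι p)) - ((covWeight 1 D.conn _ _ _).1 (coordBasis (ι p)) -
    ((covWeight 1 D.conn _ _ _).1 (coordBasis (ι p)) + (covWeight 1 D.conn _ _ _).1 (coordBasis (ι p))))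
  rw [hTv, covWeightAlong, weightOfBasis_apply, D.covWeight_apply 1 (fun y => covWeight 1 D.conn lM y
      (FiberBundle.extend (Model m) (dmap n ι p Y) y)) (ι p) (dmap n ι p X), mvfderiv_congr he1,
    mvfderiv_congr he2, hd1, hd2, lineForm_apply, FiberBundle.extend_apply_self,
    FiberBundle.extend_apply_self, Finset.sum_add_distrib]
  ring

/-- The horizontal Hessian differs from the Hessian of an extension by the derivative in the
direction of the fundamental form. -/
theorem hessBar_eq [T2Space M] (hι : ContMDiff (𝓡 n) (𝓡 m) ∞ ι)
    {l : ∀ q : N, weightSpace m 1 (TangentSpace (𝓡 m) (ι q))}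
    {lM : ∀ x : M, weightSpace m 1 (TangentSpace (𝓡 m) x)} (hl : ∀ q, lM (ι q) = l q) {U : Set M}
    (hU : IsOpen U) (hNU : Set.range ι ⊆ U) (hs : ∀ x ∈ U, SmoothWeightAt 1 lM x) (p : N)
    (X Y : TangentSpace (𝓡 n) p) :
    hessBar c D.conn ι l p X Y = hess D.conn lM (ι p) (dmap n ι p X) (dmap n ι p Y) +
      D.covWeightₗ lM (ι p) (fundForm c D.conn ι p X Y) := by
  have h1 : ∀ (q : N) (Z : TangentSpace (𝓡 n) q), covWeightAlong D.conn ι l q Z =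
      covWeight 1 D.conn lM (ι q) (dmap n ι q Z) := fun q Z =>
    covWeightAlong_eq D.conn hl (hs _ (hNU ⟨q, rfl⟩)) ((hι q).mdifferentiableAt (by simp)) Z
  have hev : ∀ᶠ y in 𝓝 (ι p), SmoothWeightAt 1 lM y := by
    filter_upwards [hU.mem_nhds (hNU ⟨p, rfl⟩)] with y hy using hs y hy
  simp only [hessBar, h1]
  rw [D.covWeightAlong_covWeight hι hev, fundForm, map_sub, covWeightₗ_apply, covWeightₗ_apply]
  abel

end WeylStructure

/-- The metric `g_l` in the chart at `x`. -/
theorem ConformalStructure.metric_eq_localRep (c : ConformalStructure m M)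
    (l : ∀ x : M, weightSpace m 1 (TangentSpace (𝓡 m) x)) {x y : M}
    (hy : y ∈ (chartAt (Model m) x).source) (V W : TangentSpace (𝓡 m) y) :
    c.metric l y V W =
      c.localRep x y V W / ((l y).1 (fun i => coordFrame x i y)) ^ 2 := by
  set b := frameBasis x y hy
  have hd : (0 : ℝ) < |b.det (coordBasis y)| :=
    abs_pos.2 (b.isUnit_det (coordBasis y)).ne_zero
  rw [ConformalStructure.metric, ConformalStructure.localRep, ← coe_frameBasis x y hy,
    weightSpace_apply_basis (c.form y V W) b (coordBasis y),
    weightSpace_apply_basis (l y) b (coordBasis y), mul_pow, ← Real.rpow_mul_natCast hd.le]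
  rw [show -1 / (m : ℝ) * ((2 : ℕ) : ℝ) = -2 / m by push_cast; ring,
    mul_div_mul_left _ _ (Real.rpow_pos_of_pos hd _).ne']

/-- The difference `∇ - ∇^l` of a Weyl connection and a Levi-Civita connection of `g_l` is
determined by `∇l`. -/
theorem WeylStructure.repForm_cov_sub (D : WeylStructure c) {D₀ : Conn m M} {U : Set M}
    {l : ∀ x : M, weightSpace m 1 (TangentSpace (𝓡 m) x)} (h₀ : IsLeviCivitaOn (c.metric l) D₀ U)
    {x : M} (hxU : x ∈ U) (hl : SmoothWeightAt 1 l x) (hne : l x ≠ 0) :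
    ∃ γ : TangentSpace (𝓡 m) x → ℝ, (∀ X, covWeight 1 D.conn l x X = γ X • l x) ∧
      ∀ X Y Z, c.repForm x (D.conn (FiberBundle.extend (Model m) Y) x X -
        D₀ (FiberBundle.extend (Model m) Y) x X) Z =
      γ X * c.repForm x Y Z + γ Y * c.repForm x X Z - γ Z * c.repForm x X Y := by
  have hx := mem_chart_source (Model m) x
  set f : M → ℝ := fun y => (l y).1 (fun i => coordFrame x i y)
  have hfd : MDifferentiableAt (𝓡 m) 𝓘(ℝ, ℝ) f x := hl.mdifferentiableAt (by simp)
  have hfx : f x ≠ 0 := by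
    have := weightSpace_apply_ne_zero (coordBasis x) hne
    rwa [coe_coordBasis] at this
  have hfx' : (l x).1 (coordBasis x) = f x := by rw [coe_coordBasis]
  refine ⟨fun X => D.lineForm x X + mvfderiv (𝓡 m) f x X / f x, fun X => ?_, ?_⟩
  · refine weightSpace_ext (coordBasis x) ?_
    rw [D.covWeight_apply]
    change _ = (_ + _) * (l x).1 (coordBasis x)
    rw [hfx']
    field_simp
    ring
  refine IsScalarProduct.koszul_identity (c.isScalarProduct x)
    (A := fun X Y => D.conn (FiberBundle.extend (Model m) Y) x X -
        D₀ (FiberBundle.extend (Model m) Y) x X) (fun X Y => ?_) fun X Y Z => ?_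
  · have h := h₀.torsion_free x hxU _ _ (mdifferentiableAt_extend_of_mem X hx)
      (mdifferentiableAt_extend_of_mem Y hx)
    rw [mlieBracket_extend, FiberBundle.extend_apply_self, FiberBundle.extend_apply_self] at h
    change _ - _ = _ - _
    rw [sub_eq_zero.1 h, D.cov_extend_comm]
  · have hY := mdifferentiableAt_extend_of_mem Y hx
    have hZ := mdifferentiableAt_extend_of_mem Z hx
    have h := h₀.metric x hxU X _ _ hY hZ
    have hr := c.mdifferentiableAt_localRep hY hZ
    have hinv : HasFDerivAt (fun t : ℝ => (t ^ 2)⁻¹) _ (f x) :=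
      (((hasDerivAt_pow 2 (f x)).inv (pow_ne_zero 2 hfx))).hasFDerivAt
    have hi := mdifferentiableAt_comp_of_hasFDerivAt (f := f) (g := fun t : ℝ => (t ^ 2)⁻¹) hinv hfd
    have hi2 := mvfderiv_comp_of_hasFDerivAt (f := f) (g := fun t : ℝ => (t ^ 2)⁻¹) hinv hfd X
    have he : (fun y => c.metric l y (FiberBundle.extend (Model m) Y y)
        (FiberBundle.extend (Model m) Z y)) =ᶠ[𝓝 x] fun y => c.localRep x y
          (FiberBundle.extend (Model m) Y y) (FiberBundle.extend (Model m) Z y) * (f y ^ 2)⁻¹ := by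
      filter_upwards [chart_source_eventually (m := m) x] with y hy
      rw [c.metric_eq_localRep l hy, div_eq_mul_inv]
    rw [mvfderiv_congr he, mvfderiv_fun_mul hr hi] at h
    simp only [add_apply, smul_apply, hi2, D.mvfderiv_localRep X hY hZ, c.metric_eq_localRep l hx,
      FiberBundle.extend_apply_self, c.localRep_self, ← c.repForm_apply, smul_eq_mul,
      ContinuousLinearMap.toSpanSingleton_apply] at h
    change c.repForm x (_ - _) Z + c.repForm x Y (_ - _) = _
    simp only [map_sub, LinearMap.sub_apply]
    have hff : (l x).1 (fun i => coordFrame x i x) = f x := rfl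
    rw [hff] at h
    field_simp at h ⊢
    simp only [Nat.cast_ofNat, Nat.add_one_sub_one, pow_one] at h
    refine mul_left_cancel₀ hfx ?_
    linarith

/-- Two connections have the same derivative of the components of a vector field along `N`. -/
theorem covTangent_sub (D D₀ : Conn m M) (p : N) (X Y : TangentSpace (𝓡 n) p) :
    covTangent D ι p X Y - covTangent D₀ ι p X Y =
      D (FiberBundle.extend (Model m) (dmap n ι p Y)) (ι p) (dmap n ι p X) -
        D₀ (FiberBundle.extend (Model m) (dmap n ι p Y)) (ι p) (dmap n ι p X) := by
  have h := FiberBundle.extend_apply_self (F := Model n) Y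
  simp only [covTangent, covAlong, h]
  abel

/-- If `N` is minimal for `g_l`, the mean curvature with respect to a Weyl structure `∇` is
determined by `∇l`. -/
theorem WeylStructure.meanCurv_smul (D : WeylStructure c) (hn : n ≠ 0) {U : Set M}
    {l : ∀ x : M, weightSpace m 1 (TangentSpace (𝓡 m) x)} (hmin : IsMinimalFor n c ι U l) {p : N}
    (hp : Function.Injective (dmap (m := m) n ι p)) (hpU : ι p ∈ U) (hl : SmoothWeightAt 1 l (ι p))
    (hne : l (ι p) ≠ 0) {ξ : TangentSpace (𝓡 m) (ι p)}
    (hξ : ∀ Z : TangentSpace (𝓡 n) p, c.repForm (ι p) ξ (dmap n ι p Z) = 0) :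
    meanCurv (n := n) c D.conn ι p ξ • l (ι p) = - D.covWeightₗ l (ι p) ξ := by
  obtain ⟨D₀, hD₀, hH⟩ := hmin
  obtain ⟨γ, hγ, hA⟩ := D.repForm_cov_sub hD₀ hpU hl hne
  have hs := (c.isScalarProduct (ι p)).symm
  have hg := c.isScalarProduct_repNForm hp
  have hcurv : ∀ D : Conn m M, meanCurv (n := n) c D ι p ξ = 1 / (n : ℝ) * bilinTrace
      (repN (n := n) c ι p) (coordBasis (m := n) p) fun X Y =>
        c.repForm (ι p) (fundForm c D ι p X Y) ξ := fun D => by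
    have h := bilinTrace_map (repN (n := n) c ι p) (coordBasis (m := n) p) (fundForm c D ι p)
      (LinearMap.flip (c.repForm (ι p)) ξ)
    simp only [LinearMap.flip_apply] at h
    rw [h]
    rfl
  have hB : ∀ X Y : TangentSpace (𝓡 n) p, c.repForm (ι p) (fundForm c D.conn ι p X Y) ξ =
      c.repForm (ι p) (fundForm c D₀ ι p X Y) ξ - c.repNForm ι p X Y * γ ξ := by
    intro X Y
    have h1 : ∀ (D : Conn m M), c.repForm (ι p) (fundForm c D ι p X Y) ξ =
        c.repForm (ι p) (covTangent D ι p X Y) ξ := fun D => by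
      rw [fundForm, map_sub, LinearMap.sub_apply, hs (dmap n ι p _) ξ, hξ, sub_zero]
    have h2 := hA (dmap n ι p X) (dmap n ι p Y) ξ
    rw [← covTangent_sub, map_sub, LinearMap.sub_apply, hs (dmap n ι p Y) ξ, hξ,
      hs (dmap n ι p X) ξ, hξ] at h2
    rw [h1, h1, c.repNForm_apply]
    linarith
  have htr : bilinTrace (repN (n := n) c ι p) (coordBasis (m := n) p) (fun X Y =>
      c.repForm (ι p) (fundForm c D.conn ι p X Y) ξ) = bilinTrace (repN (n := n) c ι p)
        (coordBasis (m := n) p) (fun X Y => c.repForm (ι p) (fundForm c D₀ ι p X Y) ξ) -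
        n * γ ξ := by
    have h1 := hg.bilinTrace_self (coordBasis (m := n) p)
    change bilinTrace (repN (n := n) c ι p) _ _ = _ at h1
    rw [← h1]
    simp only [hB, bilinTrace, mul_sub, Finset.sum_sub_distrib, smul_eq_mul, Finset.sum_mul,
      mul_assoc]
  have hn' : (n : ℝ) ≠ 0 := Nat.cast_ne_zero.2 hn
  have hm0 : meanCurv (n := n) c D.conn ι p ξ = -γ ξ := by
    have h0 := hH p ξ
    rw [hcurv] at h0 ⊢
    rw [htr, mul_sub, h0]
    field_simp
    ring
  rw [hm0, D.covWeightₗ_apply, hγ]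
  exact neg_smul (γ ξ) (l (ι p))

end Submanifold

end ConfGeom

theorem proposition4p15 {m n : ℕ} (hn : 2 ≤ n) (hnm : n < m)
    {M : Type*} [TopologicalSpace M] [T2Space M] [SecondCountableTopology M]
    [ChartedSpace (Model m) M] [IsManifold (𝓡 m) ∞ M]
    {N : Type*} [TopologicalSpace N] [T2Space N] [SecondCountableTopology N]
    [ChartedSpace (Model n) N] [IsManifold (𝓡 n) ∞ N]
    -- the conformal manifold `(M, c)` and the submanifold `ι : N → M`
    (c : ConformalStructure m M)
    (ι : N → M) (hι : ContMDiff (𝓡 n) (𝓡 m) ∞ ι) (hdι : ∀ p, Function.Injective (dmap (m := m) n ι p))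
    -- a non-vanishing section `l` of `L` over `N`
    (l : ∀ p : N, weightSpace m 1 (TangentSpace (𝓡 m) (ι p))) (hl : ∀ p, l p ≠ 0)
    -- a smooth non-vanishing extension of `l` to a neighbourhood `U` of `N` in `M`,
    -- for whose metric `N` is minimal
    (U : Set M) (hU : IsOpen U) (hNU : Set.range ι ⊆ U)
    (lmin : ∀ x : M, weightSpace m 1 (TangentSpace (𝓡 m) x))
    (hsmooth : ∀ x ∈ U, SmoothWeightAt 1 lmin x) (hne : ∀ x ∈ U, lmin x ≠ 0)
    (hext : ∀ p, lmin (ι p) = l p) (hmin : IsMinimalFor n c ι U lmin)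
    -- Weyl structures used to compute the two operators
    (D D' : WeylStructure c)
    (p : N) (X Y : TangentSpace (𝓡 n) p) :
    inducedMobius c D ι l p X Y =
      traceFree (repN (n := n) c ι p) (coordBasis (m := n) p)
        (fun X Y => mobius c D' lmin (ι p) (dmap n ι p X) (dmap n ι p Y)) X Y := by
  have hlev : ∀ᶠ y in nhds (ι p), SmoothWeightAt 1 lmin y := by
    filter_upwards [hU.mem_nhds (hNU ⟨p, rfl⟩)] with y hy using hsmooth y hy
  have hpU : ι p ∈ U := hNU ⟨p, rfl⟩
  have hn0 : n ≠ 0 := by omega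
  obtain ⟨a, ha⟩ := D.exists_hess_add_schouten_eq (by omega) hlev
  rw [D.mobius_eq D' (by omega) hlev]
  set T := D.covWeightₗ lmin (ι p)
  have hP : ∀ X Y, opP c D.conn ι l p X Y =
      (mobius c D lmin (ι p) (dmap n ι p X) (dmap n ι p Y) + T (fundForm c D.conn ι p X Y)) +
        c.repNForm ι p X Y • a := fun X Y => by
    rw [opP, D.hessBar_eq hι hext hU hNU hsmooth, ← hext p, add_right_comm, ha, c.repNForm_apply]
    abel
  have h1 := (c.isScalarProduct_repNForm (hdι p)).traceFree_congr (coordBasis (m := n) p) hn0 hP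
  change traceFree (repN (n := n) c ι p) _ _ = traceFree (repN (n := n) c ι p) _ _ at h1
  rw [inducedMobius, h1, traceFree_add, traceFree_map, ← hext p,
    D.meanCurv_smul hn0 hmin (hdι p) hpU (hsmooth _ hpU) (hne _ hpU)
      (repForm_fundForm₀_dmap (hdι p) D.conn X Y)]
  exact add_neg_cancel_right _ _
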